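/- Let $\xi_1,\xi_2,\dots$ be i.i.d. uniform $(0,1)$ random variables, with order statistics $\xi_{n1}\le\dots\le\xi_{nn}$ of the first $n$ of them. Kernel estimator. Let $k$ be a bounded probability density on $\mathbb R$ with zero mean and finite variance whose distribution function is differentiable, and let $b=b_n>0$ satisfy $b_n\to0$ and $nb_n\to\infty$. Put $$F_{n,b}(t)=\frac1{nb}\sum_{i=1}^n\int_{-\infty}^t k\Big(\frac{x-\xi_i}{b}\Big)\,dx ,\qquad F_{n,b}^{-1}(u)=\inf\{t: F_{n,b}(t)\ge u\}.$$ Scores. Let $c_{n1},\dots,c_{nn}$ ($n\ge1$) be real constants and let $J_n(t)=c_{ni}$ for $(i-1)/n<t\le i/n$, $1\le i\le n$, $J_n(0)=c_{n1}$. Let $J$ be a measurable function on $(0,1)$. Let $g$ be a left-continuous function on $(0,1)$ that is of bounded variation on $(\theta,1-\theta)$ for every $\theta\in(0,1/2)$, let $d|g|$ be the total variation measure of $dg$ on $(0,1)$, and put $\mu_n=\int_0^1 g(t)J_n(t)\,dt$. Boundedness assumption (Assumption 3). For some $M,b_1,b_2,\delta>0$, with $$B(t)=Mt^{-b_1}(1-t)^{-b_2},\quad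 D(t)=Mt^{-1+b_1+\delta}(1-t)^{-1+b_2+\delta},\quad h(t)=[t(1-t)]^{1-\delta/2},$$ one has $|g|\le D$, $|J_n|\le B$ for all $n\ge1$, and $|J|\le B$ on $(0,1)$, and $\int_0^1 B\,h\,d|g|<\infty$. Corollary 2. If in addition $\lim_{n\to\infty}\mu_n=\mu_\infty$ exists and is finite, then with probability one $$\lim_{n\to\infty}T_n=\mu_\infty ,$$ both for the kernel statistic $T_n=\int_0^1 g(F_{n,b}^{-1}(u))\,J_n(u)\,du$, where the integral extends over those $u\in(0,1)$ with $F_{n,b}^{-1}(u)\in(0,1)$ (the domain of $g$), and for the linear combination of order statistics $T_n=\frac1n\sum_{i=1}^n c_{ni}\,g(\xi_{ni})$. -/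

import Mathlib

open MeasureTheory ProbabilityTheory Filter Topology Set

noncomputable section

namespace KernelLStat

/-! ### Kernel, bandwidth and the kernel distribution function estimator -/

/-- The kernel distribution function `K` with density `k`. -/
def kernelCDF (k : ℝ → ℝ) (x : ℝ) : ℝ := ∫ t in Iic x, k t

/-- `k` is a bounded probability density with zero mean and finite variance whose
distribution function is differentiable. -/
structure KernelAssumption (k : ℝ → ℝ) : Prop where
  nonneg : ∀ x, 0 ≤ k x
  integrable : Integrable k
  integral_eq_one : ∫ x, k x = 1
  bounded : ∃ C : ℝ, ∀ x, k x ≤ C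
  integrable_mean : Integrable fun x => x * k x
  mean_zero : ∫ x, x * k x = 0
  finite_variance : Integrable fun x => x ^ 2 * k x
  differentiable : Differentiable ℝ (kernelCDF k)

/-- The smoothing parameter is positive, with `b → 0` and `n b → ∞` as `n → ∞`. -/
structure BandwidthAssumption (b : ℕ → ℝ) : Prop where
  pos : ∀ n, 1 ≤ n → 0 < b n
  tendsto_zero : Tendsto b atTop (𝓝 0)
  tendsto_mul : Tendsto (fun n : ℕ => (n : ℝ) * b n) atTop atTop

/-- `F_{n,b}(t) = (n b)⁻¹ ∑_{i ≤ n} ∫_{-∞}^t k((x - ξ_i) / b) dx`, for the sample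
`x 0, …, x (n - 1)` and the bandwidth `b`. -/
def kernelEstimator (k : ℝ → ℝ) (b : ℝ) (n : ℕ) (x : ℕ → ℝ) (t : ℝ) : ℝ :=
  1 / ((n : ℝ) * b) * ∑ i ∈ Finset.range n, ∫ s in Iic t, k ((s - x i) / b)

/-- The left-continuous inverse `u ↦ inf {t | u ≤ F t}`. -/
def leftInverse (F : ℝ → ℝ) (u : ℝ) : ℝ := sInf {t | u ≤ F t}

/-! ### The class `𝒢` and the measure `d|g|` -/

/-- Left-continuous functions on `(0, 1)` that are of bounded variation on `(θ, 1 - θ)` for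
all `θ ∈ (0, 1/2)`. Only the values of `g` on `(0, 1)` matter. -/
structure MemG (g : ℝ → ℝ) : Prop where
  leftCont : ∀ t ∈ Ioo (0 : ℝ) 1, ContinuousWithinAt g (Iic t) t
  boundedVar : ∀ θ ∈ Ioo (0 : ℝ) (1 / 2), BoundedVariationOn g (Ioo θ (1 - θ))

/-- `g` frozen outside `[θ, 1 - θ]`. -/
def freeze (g : ℝ → ℝ) (θ : ℝ) (t : ℝ) : ℝ := g (max θ (min t (1 - θ)))

/-- The truncation level `1 / (m + 3)`, which lies in `(0, 1/2)` and decreases to `0`. -/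
def level (m : ℕ) : ℝ := 1 / ((m : ℝ) + 3)

theorem level_mem (m : ℕ) : 0 < level m ∧ level m < 1 / 2 := by
  have hm : (0 : ℝ) ≤ m := Nat.cast_nonneg m
  refine ⟨by unfold level; positivity, ?_⟩
  unfold level
  exact one_div_lt_one_div_of_lt (by norm_num) (by linarith)

theorem MemG.boundedVariationOn_freeze {g : ℝ → ℝ} (hg : MemG g) (m : ℕ) :
    BoundedVariationOn (freeze g (level m)) univ := by
  obtain ⟨h0, h1⟩ := level_mem m
  have hb := hg.boundedVar (level m / 2) ⟨by linarith, by linarith⟩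
  refine ne_top_of_le_ne_top hb ?_
  refine eVariationOn.comp_le_of_monotoneOn g (fun t => max (level m) (min t (1 - level m)))
    ?_ ?_
  · intro x _ y _ hxy
    exact max_le_max le_rfl (min_le_min hxy le_rfl)
  · intro x _
    refine ⟨lt_of_lt_of_le (by linarith) (le_max_left _ _), ?_⟩
    exact lt_of_le_of_lt (max_le (by linarith) (min_le_right _ _)) (by linarith)

/-- The measure `d|g|` on `(0, 1)`: on each `(θ, 1 - θ)` it is the total variation of the
Lebesgue–Stieltjes signed measure `dg`. -/
def variationMeasure (g : ℝ → ℝ) (hg : MemG g) : Measure ℝ :=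
  ⨆ m : ℕ, ((hg.boundedVariationOn_freeze m).vectorMeasure.variation).restrict
    (Ioo (level m) (1 - level m))

/-! ### Scores and the boundedness assumption -/

/-- The score function `J_n`: `J_n(t) = c_{ni}` for `(i - 1) / n < t ≤ i / n`, `1 ≤ i ≤ n`, and
`J_n(0) = c_{n1}`. -/
def scoreFun (c : ℕ → ℕ → ℝ) (n : ℕ) (t : ℝ) : ℝ :=
  if t ≤ 0 then c n 1 else c n ⌈(n : ℝ) * t⌉₊

/-- `B(t) = M t^{-b₁} (1 - t)^{-b₂}`. -/
def boundB (M b₁ b₂ : ℝ) (t : ℝ) : ℝ := M * t ^ (-b₁) * (1 - t) ^ (-b₂)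

/-- `D(t) = M t^{-1 + b₁ + δ} (1 - t)^{-1 + b₂ + δ}`. -/
def boundD (M b₁ b₂ δ : ℝ) (t : ℝ) : ℝ := M * t ^ (-1 + b₁ + δ) * (1 - t) ^ (-1 + b₂ + δ)

/-- `h(t) = [t (1 - t)]^{1 - δ/2}`. -/
def weightH (δ : ℝ) (t : ℝ) : ℝ := (t * (1 - t)) ^ (1 - δ / 2)

/-- `|g| ≤ D`, `|J_n| ≤ B` and `|J| ≤ B` on `(0, 1)`, and `∫₀¹ B h d|g| < ∞`. -/
structure BoundednessAssumption (g : ℝ → ℝ) (hg : MemG g) (c : ℕ → ℕ → ℝ) (J : ℝ → ℝ)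
    (M b₁ b₂ δ : ℝ) : Prop where
  g_le : ∀ t ∈ Ioo (0 : ℝ) 1, |g t| ≤ boundD M b₁ b₂ δ t
  scoreFun_le : ∀ n, 1 ≤ n → ∀ t ∈ Ioo (0 : ℝ) 1, |scoreFun c n t| ≤ boundB M b₁ b₂ t
  J_le : ∀ t ∈ Ioo (0 : ℝ) 1, |J t| ≤ boundB M b₁ b₂ t
  integral_lt_top :
    ∫⁻ t in Ioo (0 : ℝ) 1, ENNReal.ofReal (boundB M b₁ b₂ t * weightH δ t)
      ∂(variationMeasure g hg) < ⊤

/-! ### The statistics -/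

/-- `μ_n = ∫₀¹ g J_n dF` with `F` the uniform distribution function. -/
def centering (g : ℝ → ℝ) (c : ℕ → ℕ → ℝ) (n : ℕ) : ℝ :=
  ∫ t in Ioo (0 : ℝ) 1, g t * scoreFun c n t

/-- The kernel form `∫₀¹ g(F_{n,b}⁻¹) J_n dF`. As `g` lives on `(0, 1)` only, the integral
extends over those `u` for which `F_{n,b}⁻¹(u) ∈ (0, 1)`. -/
def kernelStat (k : ℝ → ℝ) (b : ℕ → ℝ) (g : ℝ → ℝ) (c : ℕ → ℕ → ℝ) (n : ℕ) (x : ℕ → ℝ) : ℝ :=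
  ∫ u in {u | u ∈ Ioo (0 : ℝ) 1 ∧
      leftInverse (kernelEstimator k (b n) n x) u ∈ Ioo (0 : ℝ) 1},
    g (leftInverse (kernelEstimator k (b n) n x) u) * scoreFun c n u

/-- The order statistics of the sample `x 0, …, x (n - 1)`; the index `i : Fin n` gives the
`(i + 1)`-st smallest value. -/
def orderStat (n : ℕ) (x : ℕ → ℝ) (i : Fin n) : ℝ :=
  ((fun j : Fin n => x j) ∘ Tuple.sort (fun j : Fin n => x j)) i

/-- The order-statistics form `n⁻¹ ∑_{i ≤ n} c_{ni} g(ξ_{ni})`. -/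
def orderStatSum (g : ℝ → ℝ) (c : ℕ → ℕ → ℝ) (n : ℕ) (x : ℕ → ℝ) : ℝ :=
  1 / (n : ℝ) * ∑ i : Fin n, g (orderStat n x i) * c n ((i : ℕ) + 1)

end KernelLStat

end

/-!
For a probability measure `κ` on `ℝ` put `L(κ) = ∫₀¹ g(κ⁻¹(u)) J_n(u) du`, with `κ⁻¹` the quantile
function. Both statistics have this form: the linear combination of order statistics is `L` of the
empirical measure, the kernel statistic is `L` of its smoothing by the kernel. On the other hand
`μ_n` is `L` of the uniform law, so that `T_n - μ_n = ∫₀¹ (g(κ_n⁻¹(u)) - g(u)) J_n(u) du`. Almost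
surely `κ_n⁻¹(u) → u` for every `u`, and `g` is continuous almost everywhere because it is locally
of bounded variation; as `J_n` is bounded locally in `(0, 1)`, the integrand tends to zero almost
everywhere.

It remains to see that the integrand is bounded in `L^p` for some `p > 1`. Almost surely the tails
satisfy `t^r ≤ C max(κ_n(-∞, t), 1/n)` for any given `r > 1`. With `r` close to `1` this allows to
replace `u` by `κ_n⁻¹(u)` in the bound for `J_n`, and `|g| ≤ D` then bounds the integrand by a
multiple of `w(κ_n⁻¹(u))`, where `w(t) = (t (1 - t))^(-β)` with `β < 1`. As `κ_n⁻¹` transports the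
uniform law to `κ_n`, the `p`-th moment is at most `∫ w^p dκ_n`. For the empirical measure this is
bounded by the strong law of large numbers. For the smoothed measure it is the mean of the smoothed
weights over the sample; as `k` is bounded and `n b_n` is bounded below, these are at most
`C n^(1/q)` for some `q > 1`, and a Chernoff bound together with the Borel–Cantelli lemma applies.
-/

noncomputable section

namespace KernelLStat

open scoped ENNReal NNReal

/-! ### Uniform integrability and the growth bounds -/

theorem unifIntegrable_of_eLpNorm_le {ι α E : Type*} [MeasurableSpace α] {μ : Measure α}
    [NormedAddCommGroup E] {f : ι → α → E} {p q : ℝ≥0∞} (hq : q ≠ 0) (hqp : q < p)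
    (hf : ∀ i, AEStronglyMeasurable (f i) μ) {C : ℝ≥0} (hle : ∀ i, eLpNorm (f i) p μ ≤ C) :
    UnifIntegrable f q μ := by
  intro ε hε
  set e : ℝ := 1 / q.toReal - 1 / p.toReal with he
  have he0 : 0 < e := by
    have hq0 := ENNReal.toReal_pos hq hqp.ne_top
    rcases eq_or_ne p ∞ with rfl | hp
    · simpa [he] using hq0
    · exact sub_pos.2 (one_div_lt_one_div_of_lt hq0 (ENNReal.toReal_strict_mono hp hqp))
  have hlim : Tendsto (fun δ : ℝ => (C : ℝ) * δ ^ e) (𝓝[>] 0) (𝓝 0) := by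
    have h := (Real.continuousAt_rpow_const 0 e (Or.inr he0.le)).tendsto.const_mul (C : ℝ)
    simpa [Real.zero_rpow he0.ne'] using h.mono_left (nhdsWithin_le_nhds (s := Ioi 0))
  obtain ⟨δ, hδε, hδ⟩ := ((hlim.eventually_le_const hε).and self_mem_nhdsWithin).exists
  refine ⟨δ, hδ, fun i s hs hμs => ?_⟩
  calc eLpNorm (s.indicator (f i)) q μ
      = eLpNorm (f i) q (μ.restrict s) := eLpNorm_indicator_eq_eLpNorm_restrict hs
    _ ≤ eLpNorm (f i) p (μ.restrict s) * μ.restrict s univ ^ e :=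
        eLpNorm_le_eLpNorm_mul_rpow_measure_univ hqp.le (hf i).restrict
    _ ≤ C * ENNReal.ofReal δ ^ e := by
        rw [Measure.restrict_apply_univ]
        gcongr
        exact (eLpNorm_restrict_le ..).trans (hle i)
    _ ≤ ENNReal.ofReal ε := by
        rw [← ENNReal.ofReal_coe_nnreal, ENNReal.ofReal_rpow_of_pos hδ,
          ← ENNReal.ofReal_mul C.coe_nonneg]
        exact ENNReal.ofReal_le_ofReal hδε

theorem tendsto_integral_zero_of_eLpNorm_le {α E : Type*} [MeasurableSpace α] {μ : Measure α}
    [IsFiniteMeasure μ] [NormedAddCommGroup E] [NormedSpace ℝ E] {f : ℕ → α → E} {p : ℝ≥0∞}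
    (hp : 1 < p) (hf : ∀ᶠ n in atTop, AEStronglyMeasurable (f n) μ) {C : ℝ≥0}
    (hle : ∀ᶠ n in atTop, eLpNorm (f n) p μ ≤ C)
    (hlim : ∀ᵐ x ∂μ, Tendsto (fun n => f n x) atTop (𝓝 0)) :
    Tendsto (fun n => ∫ x, f n x ∂μ) atTop (𝓝 0) := by
  obtain ⟨N, hN⟩ := eventually_atTop.1 (hf.and hle)
  have hf' (n : ℕ) : AEStronglyMeasurable (f (n + N)) μ := (hN _ (Nat.le_add_left N n)).1
  have hle' (n : ℕ) : eLpNorm (f (n + N)) p μ ≤ C := (hN _ (Nat.le_add_left N n)).2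
  have hL : Tendsto (fun n => eLpNorm (f (n + N) - 0) 1 μ) atTop (𝓝 0) :=
    tendsto_Lp_finite_of_tendsto_ae le_rfl ENNReal.one_ne_top hf' MemLp.zero
      (unifIntegrable_of_eLpNorm_le one_ne_zero hp hf' hle')
      (hlim.mono fun x hx => hx.comp (tendsto_add_atTop_nat N))
  rw [← tendsto_add_atTop_iff_nat N]
  simpa using tendsto_integral_of_L1' (fun _ => 0) aestronglyMeasurable_const
    (Eventually.of_forall fun n => memLp_one_iff_integrable.1
      (MemLp.mono_exponent ⟨hf' n, (hle' n).trans_lt ENNReal.coe_lt_top⟩ hp.le)) hL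

/-- The growth conditions `|g| ≤ D` and `|J_n| ≤ B` on `(0, 1)`, which are the part of
`BoundednessAssumption` that makes `g (F_n⁻¹) J_n` bounded in `L^p` for some `p > 1`. -/
structure GrowthBound (g : ℝ → ℝ) (c : ℕ → ℕ → ℝ) (M b₁ b₂ δ : ℝ) : Prop where
  M_pos : 0 < M
  b₁_pos : 0 < b₁
  b₂_pos : 0 < b₂
  δ_pos : 0 < δ
  g_le : ∀ t ∈ Ioo (0 : ℝ) 1, |g t| ≤ boundD M b₁ b₂ δ t
  scoreFun_le : ∀ n, 1 ≤ n → ∀ t ∈ Ioo (0 : ℝ) 1, |scoreFun c n t| ≤ boundB M b₁ b₂ t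

theorem scoreFun_of_pos {c : ℕ → ℕ → ℝ} {n : ℕ} {t : ℝ} (ht : 0 < t) :
    scoreFun c n t = c n ⌈(n : ℝ) * t⌉₊ := if_neg ht.not_ge

theorem measurable_scoreFun (c : ℕ → ℕ → ℝ) (n : ℕ) : Measurable (scoreFun c n) :=
  Measurable.ite measurableSet_Iic measurable_const
    (measurable_from_nat.comp (Nat.measurable_ceil.comp (measurable_const_mul _)))

theorem boundB_le_of_le {M b₁ b₂ s t v : ℝ} (hM : 0 ≤ M) (hb₁ : 0 ≤ b₁) (hb₂ : 0 ≤ b₂)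
    (hs : 0 < s) (ht : 0 < t) (hsv : s ≤ v) (htv : t ≤ 1 - v) :
    boundB M b₁ b₂ v ≤ M * s ^ (-b₁) * t ^ (-b₂) := by
  have hleft := Real.rpow_le_rpow_of_nonpos hs hsv (neg_nonpos.2 hb₁)
  have hright := Real.rpow_le_rpow_of_nonpos ht htv (neg_nonpos.2 hb₂)
  have hv : 0 ≤ (1 - v) ^ (-b₂) := Real.rpow_nonneg (ht.le.trans htv) _
  unfold boundB
  gcongr

/-- The midpoint of the interval on which `scoreFun c n` is constant around `u`. -/
def cellMidpoint (n : ℕ) (u : ℝ) : ℝ := (⌈(n : ℝ) * u⌉₊ - 1 / 2) / n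

section cellMidpoint

variable {n : ℕ} {u : ℝ}

theorem ceil_mul_cellMidpoint (hn : 1 ≤ n) (hu : 0 < u) :
    ⌈(n : ℝ) * cellMidpoint n u⌉₊ = ⌈(n : ℝ) * u⌉₊ := by
  have hn0 : (0 : ℝ) < n := by exact_mod_cast hn
  have hpos : 0 < ⌈(n : ℝ) * u⌉₊ := Nat.ceil_pos.2 (mul_pos hn0 hu)
  rw [cellMidpoint, mul_div_cancel₀ _ hn0.ne', Nat.ceil_eq_iff hpos.ne', Nat.cast_sub hpos]
  constructor <;> push_cast <;> linarith

theorem max_div_two_le_cellMidpoint (hn : 1 ≤ n) (hu : 0 < u) :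
    max u (1 / n) / 2 ≤ cellMidpoint n u := by
  have hn0 : (0 : ℝ) < n := by exact_mod_cast hn
  have hone : (1 : ℝ) ≤ ⌈(n : ℝ) * u⌉₊ := by exact_mod_cast Nat.ceil_pos.2 (mul_pos hn0 hu)
  have hceil := Nat.le_ceil ((n : ℝ) * u)
  rw [cellMidpoint, div_le_iff₀ two_pos, div_mul_eq_mul_div, max_le_iff, le_div_iff₀ hn0,
    div_le_div_iff_of_pos_right hn0]
  constructor <;> linarith

theorem max_div_two_le_one_sub_cellMidpoint (hn : 1 ≤ n) (hu : u ∈ Ioo (0 : ℝ) 1) :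
    max (1 - u) (1 / n) / 2 ≤ 1 - cellMidpoint n u := by
  have hn0 : (0 : ℝ) < n := by exact_mod_cast hn
  have hceil : (⌈(n : ℝ) * u⌉₊ : ℝ) ≤ n := by
    exact_mod_cast Nat.ceil_le.2 (mul_le_of_le_one_right hn0.le hu.2.le)
  have hlt := Nat.ceil_lt_add_one (mul_pos hn0 hu.1).le
  rw [cellMidpoint, one_sub_div hn0.ne', div_le_iff₀ two_pos, div_mul_eq_mul_div, max_le_iff,
    le_div_iff₀ hn0, div_le_div_iff_of_pos_right hn0]
  constructor <;> linarith

end cellMidpoint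

theorem GrowthBound.abs_scoreFun_le {g : ℝ → ℝ} {c : ℕ → ℕ → ℝ} {M b₁ b₂ δ : ℝ}
    (h : GrowthBound g c M b₁ b₂ δ) {n : ℕ} (hn : 1 ≤ n) {u : ℝ} (hu : u ∈ Ioo (0 : ℝ) 1) :
    |scoreFun c n u| ≤ M * (max u (1 / n) / 2) ^ (-b₁) * (max (1 - u) (1 / n) / 2) ^ (-b₂) := by
  have hs : 0 < max u (1 / (n : ℝ)) / 2 := half_pos (lt_max_of_lt_left hu.1)
  have ht : 0 < max (1 - u) (1 / (n : ℝ)) / 2 := half_pos (lt_max_of_lt_left (sub_pos.2 hu.2))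
  have hsv := max_div_two_le_cellMidpoint hn hu.1
  have htv := max_div_two_le_one_sub_cellMidpoint hn hu
  have heq : scoreFun c n u = scoreFun c n (cellMidpoint n u) := by
    rw [scoreFun_of_pos hu.1, scoreFun_of_pos (hs.trans_le hsv), ceil_mul_cellMidpoint hn hu.1]
  rw [heq]
  exact (h.scoreFun_le n hn _ ⟨hs.trans_le hsv, sub_pos.1 (ht.trans_le htv)⟩).trans
    (boundB_le_of_le h.M_pos.le h.b₁_pos.le h.b₂_pos.le hs ht hsv htv)

theorem rpow_mul_half_rpow_le {x m C r b δ γ : ℝ} (hx : x ∈ Ioo (0 : ℝ) 1) (hC : 0 < C)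
    (hb : 0 < b) (hxm : x ^ r ≤ C * m) (hr : (r - 1) * b ≤ δ / 2) (hγ : 1 - δ / 2 ≤ γ) :
    x ^ (-1 + b + δ) * (m / 2) ^ (-b) ≤ (2 * C) ^ b * x ^ (-γ) := by
  have hx0 := hx.1
  have hm : x ^ r / (2 * C) ≤ m / 2 := by
    rw [div_le_iff₀ (by positivity)]; linarith
  calc x ^ (-1 + b + δ) * (m / 2) ^ (-b)
      ≤ x ^ (-1 + b + δ) * (x ^ r / (2 * C)) ^ (-b) := by
        gcongr 1
        exact Real.rpow_le_rpow_of_nonpos (by positivity) hm (by linarith)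
    _ = (2 * C) ^ b * x ^ (-1 + b + δ - r * b) := by
        rw [Real.div_rpow (by positivity) (by positivity), ← Real.rpow_mul hx0.le,
          Real.rpow_neg (by positivity : 0 ≤ 2 * C), sub_eq_add_neg,
          Real.rpow_add hx0 (-1 + b + δ)]
        field_simp
    _ ≤ (2 * C) ^ b * x ^ (-γ) := by
        gcongr 1
        exact Real.rpow_le_rpow_of_exponent_ge hx0 hx.2.le (by linarith)

/-- The weight `(t (1 - t)) ^ (-β)` on `(0, 1)`, extended by `0`; it dominates the products
`g (F_n⁻¹) J_n`. -/
def endWeight (β : ℝ) : ℝ → ℝ≥0∞ :=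
  (Ioo (0 : ℝ) 1).indicator fun t => ENNReal.ofReal ((t * (1 - t)) ^ (-β))

theorem measurable_endWeight (β : ℝ) : Measurable (endWeight β) :=
  Measurable.indicator (by fun_prop) measurableSet_Ioo

theorem endWeight_ne_top (β t : ℝ) : endWeight β t ≠ ∞ := by
  by_cases ht : t ∈ Ioo (0 : ℝ) 1 <;> simp [endWeight, ht]

theorem endWeight_rpow (β : ℝ) {p : ℝ} (hp : 0 < p) (t : ℝ) :
    endWeight β t ^ p = endWeight (β * p) t := by
  by_cases ht : t ∈ Ioo (0 : ℝ) 1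
  · have h : 0 < t * (1 - t) := mul_pos ht.1 (sub_pos.2 ht.2)
    simp only [endWeight, indicator_of_mem ht]
    rw [ENNReal.ofReal_rpow_of_pos (by positivity), ← Real.rpow_mul h.le, neg_mul]
  · simp only [endWeight, indicator_of_notMem ht, ENNReal.zero_rpow_of_pos hp]

theorem mul_one_sub_rpow_neg_le {β t : ℝ} (hβ : 0 ≤ β) (ht : t ∈ Ioo (0 : ℝ) 1) :
    (t * (1 - t)) ^ (-β) ≤ 2 ^ β * (t ^ (-β) + (1 - t) ^ (-β)) := by
  have ht0 := ht.1
  have ht1 : 0 < 1 - t := sub_pos.2 ht.2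
  have hfar {s : ℝ} (hs : 1 / 2 ≤ s) : s ^ (-β) ≤ 2 ^ β := by
    rw [Real.rpow_neg_eq_inv_rpow]
    exact Real.rpow_le_rpow (by positivity) (inv_le_of_inv_le₀ two_pos (by simpa using hs)) hβ
  rw [Real.mul_rpow ht0.le ht1.le]
  rcases le_total t (1 / 2) with h | h
  · calc t ^ (-β) * (1 - t) ^ (-β) ≤ t ^ (-β) * 2 ^ β := by
          gcongr; exact hfar (by linarith)
      _ ≤ 2 ^ β * (t ^ (-β) + (1 - t) ^ (-β)) := by
          rw [mul_comm]; gcongr; exact le_add_of_nonneg_right (by positivity)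
  · calc t ^ (-β) * (1 - t) ^ (-β) ≤ 2 ^ β * (1 - t) ^ (-β) := by
          gcongr; exact hfar h
      _ ≤ 2 ^ β * (t ^ (-β) + (1 - t) ^ (-β)) := by
          gcongr; exact le_add_of_nonneg_left (by positivity)

theorem lintegral_endWeight_lt_top {β : ℝ} (hβ : 0 ≤ β) (hβ1 : β < 1) :
    ∫⁻ t, endWeight β t < ∞ := by
  have hleft : IntervalIntegrable (fun t : ℝ => t ^ (-β)) volume 0 1 :=
    intervalIntegral.intervalIntegrable_rpow' (by linarith)
  have hright : IntervalIntegrable (fun t : ℝ => (1 - t) ^ (-β)) volume 0 1 := by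
    simpa using (hleft.comp_sub_left 1).symm
  have hsum : IntegrableOn (fun t : ℝ => 2 ^ β * (t ^ (-β) + (1 - t) ^ (-β))) (Ioo 0 1) :=
    (intervalIntegrable_iff_integrableOn_Ioo_of_le zero_le_one).1 ((hleft.add hright).const_mul _)
  rw [endWeight, lintegral_indicator measurableSet_Ioo]
  exact (setLIntegral_mono' measurableSet_Ioo fun t ht =>
    ENNReal.ofReal_le_ofReal (mul_one_sub_rpow_neg_le hβ ht)).trans_lt hsum.lintegral_lt_top

theorem eLpNorm_endWeight (ν : Measure ℝ) (β : ℝ) {p : ℝ} (hp : 0 < p) :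
    eLpNorm (endWeight β) (ENNReal.ofReal p) ν = (∫⁻ t, endWeight (β * p) t ∂ν) ^ (1 / p) := by
  rw [eLpNorm_eq_lintegral_rpow_enorm_toReal (by simpa using hp) ENNReal.ofReal_ne_top,
    ENNReal.toReal_ofReal hp.le]
  simp only [enorm_eq_self, endWeight_rpow β hp]

namespace GrowthBound

variable {g : ℝ → ℝ} {c : ℕ → ℕ → ℝ} {M b₁ b₂ δ : ℝ} {n : ℕ} {C r γ p : ℝ}

theorem abs_mul_scoreFun_le (h : GrowthBound g c M b₁ b₂ δ) (hn : 1 ≤ n) (hC : 0 < C)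
    (hr₁ : (r - 1) * b₁ ≤ δ / 2) (hr₂ : (r - 1) * b₂ ≤ δ / 2) (hγ : 1 - δ / 2 ≤ γ) {t u : ℝ}
    (ht : t ∈ Ioo (0 : ℝ) 1) (hu : u ∈ Ioo (0 : ℝ) 1) (hleft : t ^ r ≤ C * max u (1 / n))
    (hright : (1 - t) ^ r ≤ C * max (1 - u) (1 / n)) :
    |g t * scoreFun c n u| ≤
      M ^ 2 * ((2 * C) ^ b₁ * (2 * C) ^ b₂) * (t * (1 - t)) ^ (-γ) := by
  have ht' : 1 - t ∈ Ioo (0 : ℝ) 1 := ⟨sub_pos.2 ht.2, sub_lt_self _ ht.1⟩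
  have ht0 := ht.1
  have ht1 := ht'.1
  have hM := h.M_pos
  have : 0 < max u (1 / (n : ℝ)) := lt_max_of_lt_left hu.1
  have : 0 < max (1 - u) (1 / (n : ℝ)) := lt_max_of_lt_left (sub_pos.2 hu.2)
  have hg := h.g_le t ht
  unfold boundD at hg
  rw [abs_mul]
  calc |g t| * |scoreFun c n u|
      ≤ _ := mul_le_mul hg (h.abs_scoreFun_le hn hu) (abs_nonneg _) (by positivity)
    _ = M ^ 2 * ((t ^ (-1 + b₁ + δ) * (max u (1 / n) / 2) ^ (-b₁)) *
          ((1 - t) ^ (-1 + b₂ + δ) * (max (1 - u) (1 / n) / 2) ^ (-b₂))) := by ring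
    _ ≤ M ^ 2 * (((2 * C) ^ b₁ * t ^ (-γ)) * ((2 * C) ^ b₂ * (1 - t) ^ (-γ))) := by
        gcongr 2
        · exact rpow_mul_half_rpow_le ht hC h.b₁_pos hleft hr₁ hγ
        · exact rpow_mul_half_rpow_le ht' hC h.b₂_pos hright hr₂ hγ
    _ = M ^ 2 * ((2 * C) ^ b₁ * (2 * C) ^ b₂) * (t * (1 - t)) ^ (-γ) := by
        rw [Real.mul_rpow ht0.le ht1.le]; ring

theorem eLpNorm_comp_mul_scoreFun_le (h : GrowthBound g c M b₁ b₂ δ) (hn : 1 ≤ n) (hC : 0 < C)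
    (hr₁ : (r - 1) * b₁ ≤ δ / 2) (hr₂ : (r - 1) * b₂ ≤ δ / 2) (hγ : 1 - δ / 2 ≤ γ) (hp : 0 < p)
    {T : ℝ → ℝ} (hT : AEMeasurable T (volume.restrict (Ioo 0 1)))
    (htail : ∀ u ∈ Ioo (0 : ℝ) 1, T u ∈ Ioo (0 : ℝ) 1 →
      T u ^ r ≤ C * max u (1 / n) ∧ (1 - T u) ^ r ≤ C * max (1 - u) (1 / n)) :
    eLpNorm (fun u => (Ioo (0 : ℝ) 1).indicator g (T u) * scoreFun c n u) (ENNReal.ofReal p)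
        (volume.restrict (Ioo 0 1)) ≤
      ENNReal.ofReal (M ^ 2 * ((2 * C) ^ b₁ * (2 * C) ^ b₂)) *
        (∫⁻ t, endWeight (γ * p) t ∂(volume.restrict (Ioo 0 1)).map T) ^ (1 / p) := by
  set K : ℝ := M ^ 2 * ((2 * C) ^ b₁ * (2 * C) ^ b₂)
  have hK0 : 0 ≤ K := by positivity
  have hpt (u : ℝ) (hu : u ∈ Ioo (0 : ℝ) 1) :
      ‖(Ioo (0 : ℝ) 1).indicator g (T u) * scoreFun c n u‖ₑ ≤
        K.toNNReal * ‖endWeight γ (T u)‖ₑ := by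
    by_cases ht : T u ∈ Ioo (0 : ℝ) 1
    · obtain ⟨hleft, hright⟩ := htail u hu ht
      simp only [indicator_of_mem ht, endWeight, enorm_eq_self, Real.enorm_eq_ofReal_abs]
      rw [← ENNReal.ofReal, ← ENNReal.ofReal_mul hK0]
      exact ENNReal.ofReal_le_ofReal
        (h.abs_mul_scoreFun_le hn hC hr₁ hr₂ hγ ht hu hleft hright)
    · simp [indicator_of_notMem ht]
  calc _ ≤ K.toNNReal • eLpNorm (endWeight γ ∘ T) (ENNReal.ofReal p)
          (volume.restrict (Ioo 0 1)) :=
        eLpNorm_le_nnreal_smul_eLpNorm_of_ae_le_mul'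
          ((ae_restrict_iff' measurableSet_Ioo).2 (Eventually.of_forall hpt)) _
    _ = _ := by
        rw [← eLpNorm_map_measure (measurable_endWeight γ).aestronglyMeasurable hT,
          eLpNorm_endWeight _ _ hp, ENNReal.smul_def, smul_eq_mul, ENNReal.ofReal]

end GrowthBound

/-! ### Quantile functions and asymptotically uniform measures -/

/-- The quantile function of a probability measure on `ℝ`; it is meaningful on `(0, 1)` only. -/
def quantile (κ : Measure ℝ) (u : ℝ) : ℝ := leftInverse (cdf κ) u

section quantile

variable {κ : Measure ℝ} {u : ℝ}

theorem quantile_le_iff (hu : u ∈ Ioo (0 : ℝ) 1) {t : ℝ} : quantile κ u ≤ t ↔ u ≤ cdf κ t := by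
  set S : Set ℝ := {t | u ≤ cdf κ t}
  have hne : S.Nonempty := ((tendsto_cdf_atTop κ).eventually_const_le hu.2).exists
  have hbdd : BddBelow S := by
    obtain ⟨a, ha⟩ := ((tendsto_cdf_atBot κ).eventually_lt_const hu.1).exists
    exact ⟨a, fun t ht => le_of_not_gt fun hta => (ht.trans (monotone_cdf κ hta.le)).not_gt ha⟩
  have hmem : quantile κ u ∈ S := by
    refine ge_of_tendsto (((cdf κ).right_continuous (quantile κ u)).mono_left
      (nhdsWithin_mono _ Ioi_subset_Ici_self)) (eventually_mem_nhdsWithin.mono fun s hs => ?_)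
    obtain ⟨t, ht, hts⟩ := (csInf_lt_iff hbdd hne).1 hs
    exact ht.trans (monotone_cdf κ hts.le)
  exact ⟨fun h => hmem.trans (monotone_cdf κ h), fun h => csInf_le hbdd h⟩

theorem monotoneOn_quantile (κ : Measure ℝ) : MonotoneOn (quantile κ) (Ioo 0 1) :=
  fun _ hu _ hv huv => (quantile_le_iff hu).2 (huv.trans ((quantile_le_iff hv).1 le_rfl))

theorem aemeasurable_quantile (κ : Measure ℝ) :
    AEMeasurable (quantile κ) (volume.restrict (Ioo 0 1)) :=
  aemeasurable_restrict_of_monotoneOn measurableSet_Ioo (monotoneOn_quantile κ)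

theorem map_quantile (κ : Measure ℝ) [IsProbabilityMeasure κ] :
    (volume.restrict (Ioo 0 1)).map (quantile κ) = κ := by
  refine Measure.ext_of_Iic _ _ fun t => ?_
  have hpre : quantile κ ⁻¹' Iic t ∩ Ioo 0 1 = Iic (cdf κ t) ∩ Ioo 0 1 := by
    ext u
    exact and_congr_left fun hu => quantile_le_iff hu
  have hIoc : (Iic (cdf κ t) ∩ Ioo 0 1 : Set ℝ) =ᵐ[volume] Ioc 0 (cdf κ t) := by
    have h : (Iic (cdf κ t) ∩ Ioc 0 1 : Set ℝ) = Ioc 0 (cdf κ t) := by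
      rw [inter_comm, Ioc_inter_Iic, min_eq_right (cdf_le_one κ t)]
    rw [← h]
    exact (ae_eq_refl _).inter Ioo_ae_eq_Ioc
  rw [Measure.map_apply_of_aemeasurable (aemeasurable_quantile κ) measurableSet_Iic,
    Measure.restrict_apply' measurableSet_Ioo, hpre, measure_congr hIoc, Real.volume_Ioc, sub_zero,
    ofReal_cdf]

theorem measureReal_Iio_quantile_le [IsProbabilityMeasure κ] (hu : u ∈ Ioo (0 : ℝ) 1) :
    κ.real (Iio (quantile κ u)) ≤ u := by
  have hsub : quantile κ ⁻¹' Iio (quantile κ u) ∩ Ioo 0 1 ⊆ Ioc 0 u := fun v hv =>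
    ⟨hv.2.1, le_of_not_gt fun h => (monotoneOn_quantile κ hu hv.2 h.le).not_gt hv.1⟩
  refine ENNReal.toReal_le_of_le_ofReal hu.1.le ?_
  calc κ (Iio (quantile κ u))
      = ((volume.restrict (Ioo 0 1)).map (quantile κ)) (Iio (quantile κ u)) := by
        rw [map_quantile]
    _ = volume (quantile κ ⁻¹' Iio (quantile κ u) ∩ Ioo 0 1) := by
        rw [Measure.map_apply_of_aemeasurable (aemeasurable_quantile κ) measurableSet_Iio,
          Measure.restrict_apply' measurableSet_Ioo]
    _ ≤ volume (Ioc 0 u) := measure_mono hsub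
    _ = ENNReal.ofReal u := by rw [Real.volume_Ioc, sub_zero]

theorem measureReal_Ioi_quantile_le [IsProbabilityMeasure κ] (hu : u ∈ Ioo (0 : ℝ) 1) :
    κ.real (Ioi (quantile κ u)) ≤ 1 - u := by
  rw [← compl_Iic, probReal_compl_eq_one_sub measurableSet_Iic, ← cdf_eq_real]
  exact sub_le_sub_left ((quantile_le_iff hu).1 le_rfl) 1

end quantile

/-- The probability measures `κ n` converge to the uniform distribution on `(0, 1)`, and the
mass they give to a neighbourhood of an end point is at least a power of the length of that
neighbourhood, up to a multiple of the mass `1 / n` of a single observation. -/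
structure AsympUniform (κ : ℕ → Measure ℝ) (r : ℝ) : Prop where
  isProbabilityMeasure : ∀ᶠ n in atTop, IsProbabilityMeasure (κ n)
  tendsto_Iic : ∀ q : ℚ, (q : ℝ) ∈ Ioo (0 : ℝ) 1 →
    Tendsto (fun n => (κ n).real (Iic (q : ℝ))) atTop (𝓝 q)
  tail_le : ∃ C : ℝ, 0 < C ∧ ∀ᶠ n : ℕ in atTop, ∀ t ∈ Ioo (0 : ℝ) 1,
    t ^ r ≤ C * max ((κ n).real (Iio t)) (1 / n) ∧
      (1 - t) ^ r ≤ C * max ((κ n).real (Ioi t)) (1 / n)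

theorem AsympUniform.tendsto_quantile {κ : ℕ → Measure ℝ} {r : ℝ} (h : AsympUniform κ r) {u : ℝ}
    (hu : u ∈ Ioo (0 : ℝ) 1) : Tendsto (fun n => quantile (κ n) u) atTop (𝓝 u) := by
  rw [tendsto_order]
  constructor
  · intro a ha
    obtain ⟨q, haq, hqu⟩ := exists_rat_btwn (max_lt ha hu.1)
    obtain ⟨haq, hq0⟩ := max_lt_iff.1 haq
    filter_upwards [(h.tendsto_Iic q ⟨hq0, hqu.trans hu.2⟩).eventually_lt_const hqu,
      h.isProbabilityMeasure] with n hn _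
    rw [← cdf_eq_real] at hn
    exact haq.trans (lt_of_not_ge fun hle => ((quantile_le_iff hu).1 hle).not_gt hn)
  · intro a ha
    obtain ⟨q, huq, hqa⟩ := exists_rat_btwn (lt_min ha hu.2)
    obtain ⟨hqa, hq1⟩ := lt_min_iff.1 hqa
    filter_upwards [(h.tendsto_Iic q ⟨hu.1.trans huq, hq1⟩).eventually_const_lt huq,
      h.isProbabilityMeasure] with n hn _
    rw [← cdf_eq_real] at hn
    exact ((quantile_le_iff hu).2 hn.le).trans_lt hqa

/-- The `L`-statistic `∫₀¹ g (κ⁻¹) J_n dF` of a distribution `κ`, where `g` is extended by `0`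
outside its domain `(0, 1)`. -/
def lStat (g : ℝ → ℝ) (c : ℕ → ℕ → ℝ) (n : ℕ) (κ : Measure ℝ) : ℝ :=
  ∫ u in Ioo (0 : ℝ) 1, (Ioo (0 : ℝ) 1).indicator g (quantile κ u) * scoreFun c n u

theorem centering_eq_setIntegral_indicator (g : ℝ → ℝ) (c : ℕ → ℕ → ℝ) (n : ℕ) :
    centering g c n =
      ∫ u in Ioo (0 : ℝ) 1, (Ioo (0 : ℝ) 1).indicator g u * scoreFun c n u :=
  setIntegral_congr_fun measurableSet_Ioo fun u hu => by simp only [indicator_of_mem hu]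

theorem tendsto_mul_scoreFun_sub {g : ℝ → ℝ} {c : ℕ → ℕ → ℝ} {M b₁ b₂ δ : ℝ}
    (h : GrowthBound g c M b₁ b₂ δ) {u : ℝ} (hu : u ∈ Ioo (0 : ℝ) 1) (hg : ContinuousAt g u)
    {q : ℕ → ℝ} (hq : Tendsto q atTop (𝓝 u)) :
    Tendsto (fun n => (Ioo (0 : ℝ) 1).indicator g (q n) * scoreFun c n u -
      (Ioo (0 : ℝ) 1).indicator g u * scoreFun c n u) atTop (𝓝 0) := by
  have hcont : ContinuousAt ((Ioo (0 : ℝ) 1).indicator g) u :=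
    hg.congr (eventually_of_mem (Ioo_mem_nhds hu.1 hu.2) fun s hs => (indicator_of_mem hs g).symm)
  have hdiff : Tendsto (fun n => (Ioo (0 : ℝ) 1).indicator g (q n) -
      (Ioo (0 : ℝ) 1).indicator g u) atTop (𝓝 0) := by
    simpa only [sub_self, Function.comp_def] using
      (hcont.tendsto.comp hq).sub_const ((Ioo (0 : ℝ) 1).indicator g u)
  have hbdd : IsBoundedUnder (· ≤ ·) atTop fun n => ‖scoreFun c n u‖ :=
    isBoundedUnder_of_eventually_le
      ((eventually_ge_atTop 1).mono fun n hn => h.scoreFun_le n hn u hu)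
  simpa only [sub_mul] using hdiff.zero_mul_isBoundedUnder_le hbdd

theorem GrowthBound.exists_eventually_eLpNorm_le {g : ℝ → ℝ} {c : ℕ → ℕ → ℝ} {M b₁ b₂ δ : ℝ}
    (h : GrowthBound g c M b₁ b₂ δ) (hg : Measurable ((Ioo (0 : ℝ) 1).indicator g)) {r γ p : ℝ}
    (hr₁ : (r - 1) * b₁ ≤ δ / 2) (hr₂ : (r - 1) * b₂ ≤ δ / 2) (hγ : 1 - δ / 2 ≤ γ) (hp : 0 < p)
    {T : ℕ → ℝ → ℝ} (hT : ∀ᶠ n in atTop, AEMeasurable (T n) (volume.restrict (Ioo 0 1)))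
    (htail : ∃ C : ℝ, 0 < C ∧ ∀ᶠ n : ℕ in atTop, ∀ u ∈ Ioo (0 : ℝ) 1, T n u ∈ Ioo (0 : ℝ) 1 →
      T n u ^ r ≤ C * max u (1 / n) ∧ (1 - T n u) ^ r ≤ C * max (1 - u) (1 / n))
    (hmoment : ∃ A : ℝ≥0, ∀ᶠ n in atTop,
      ∫⁻ t, endWeight (γ * p) t ∂(volume.restrict (Ioo 0 1)).map (T n) ≤ A) :
    ∃ K : ℝ≥0, ∀ᶠ n in atTop,
      AEStronglyMeasurable (fun u => (Ioo (0 : ℝ) 1).indicator g (T n u) * scoreFun c n u)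
        (volume.restrict (Ioo 0 1)) ∧
      eLpNorm (fun u => (Ioo (0 : ℝ) 1).indicator g (T n u) * scoreFun c n u)
        (ENNReal.ofReal p) (volume.restrict (Ioo 0 1)) ≤ K := by
  obtain ⟨C, hC, htail⟩ := htail
  obtain ⟨A, hA⟩ := hmoment
  refine ⟨(M ^ 2 * ((2 * C) ^ b₁ * (2 * C) ^ b₂)).toNNReal * A ^ (1 / p), ?_⟩
  filter_upwards [hT, htail, hA, eventually_ge_atTop 1] with n hTn htailn hAn hn
  refine ⟨((hg.comp_aemeasurable hTn).mul
    (measurable_scoreFun c n).aemeasurable).aestronglyMeasurable,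
    (h.eLpNorm_comp_mul_scoreFun_le hn hC hr₁ hr₂ hγ hp hTn htailn).trans ?_⟩
  rw [ENNReal.coe_mul, ENNReal.coe_rpow_of_nonneg _ (one_div_nonneg.2 hp.le), ENNReal.ofReal]
  gcongr

theorem AsympUniform.quantile_rpow_le {κ : ℕ → Measure ℝ} {r : ℝ} (h : AsympUniform κ r) :
    ∃ C : ℝ, 0 < C ∧ ∀ᶠ n : ℕ in atTop, ∀ u ∈ Ioo (0 : ℝ) 1, quantile (κ n) u ∈ Ioo (0 : ℝ) 1 →
      quantile (κ n) u ^ r ≤ C * max u (1 / n) ∧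
        (1 - quantile (κ n) u) ^ r ≤ C * max (1 - u) (1 / n) := by
  obtain ⟨C, hC, htail⟩ := h.tail_le
  refine ⟨C, hC, ?_⟩
  filter_upwards [htail, h.isProbabilityMeasure] with n hn _ u hu hq
  refine (hn _ hq).imp (fun h => h.trans ?_) (fun h => h.trans ?_)
  · gcongr
    exact measureReal_Iio_quantile_le hu
  · gcongr
    exact measureReal_Ioi_quantile_le hu

theorem AsympUniform.tendsto_lStat_sub_centering {κ : ℕ → Measure ℝ} {r : ℝ}
    (hκ : AsympUniform κ r) {g : ℝ → ℝ} {c : ℕ → ℕ → ℝ} {M b₁ b₂ δ : ℝ}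
    (hg : Measurable ((Ioo (0 : ℝ) 1).indicator g))
    (hg_cont : ∀ᵐ t, t ∈ Ioo (0 : ℝ) 1 → ContinuousAt g t) (h : GrowthBound g c M b₁ b₂ δ)
    (hr₁ : (r - 1) * b₁ ≤ δ / 2) (hr₂ : (r - 1) * b₂ ≤ δ / 2) {β : ℝ}
    (hβ : 1 - δ / 2 < β) (hβ01 : β ∈ Ioo (0 : ℝ) 1)
    (hmoment : ∃ A : ℝ≥0, ∀ᶠ n in atTop, ∫⁻ t, endWeight β t ∂κ n ≤ A) :
    Tendsto (fun n => lStat g c n (κ n) - centering g c n) atTop (𝓝 0) := by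
  obtain ⟨γ, hγ, hγβ⟩ := exists_between (max_lt hβ hβ01.1)
  obtain ⟨hγδ, hγ0⟩ := max_lt_iff.1 hγ
  set p : ℝ := β / γ
  have hp : 1 < p := (one_lt_div hγ0).2 hγβ
  have hγp : γ * p = β := mul_div_cancel₀ β hγ0.ne'
  have hp' : 1 < ENNReal.ofReal p := ENNReal.one_lt_ofReal.2 hp
  obtain ⟨K, hK⟩ := h.exists_eventually_eLpNorm_le hg hr₁ hr₂ hγδ.le (one_pos.trans hp)
    (T := fun n => quantile (κ n)) (Eventually.of_forall fun _ => aemeasurable_quantile _)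
    hκ.quantile_rpow_le (by
      obtain ⟨A, hA⟩ := hmoment
      refine ⟨A, ?_⟩
      filter_upwards [hA, hκ.isProbabilityMeasure] with n hn _
      rwa [map_quantile, hγp])
  obtain ⟨L, hL⟩ := h.exists_eventually_eLpNorm_le hg (r := 1) (T := fun _ u => u)
    (by simpa using (half_pos h.δ_pos).le) (by simpa using (half_pos h.δ_pos).le) hγδ.le
    (one_pos.trans hp) (Eventually.of_forall fun _ => aemeasurable_id)
    ⟨1, one_pos, Eventually.of_forall fun _ u _ _ => by simp⟩ (by
      refine ⟨(∫⁻ t, endWeight β t).toNNReal, Eventually.of_forall fun _ => ?_⟩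
      rw [Measure.map_id', hγp, ENNReal.coe_toNNReal
        (lintegral_endWeight_lt_top hβ01.1.le hβ01.2).ne]
      exact setLIntegral_le_lintegral _ _)
  have hlim := tendsto_integral_zero_of_eLpNorm_le hp'
    (hK.and hL |>.mono fun n hn => hn.1.1.sub hn.2.1) (C := K + L)
    (hK.and hL |>.mono fun n hn => (eLpNorm_sub_le hn.1.1 hn.2.1 hp'.le).trans
      (by push_cast; exact add_le_add hn.1.2 hn.2.2))
    ((ae_restrict_iff' measurableSet_Ioo).2 (hg_cont.mono fun u hu hu01 =>
      tendsto_mul_scoreFun_sub h hu01 (hu hu01) (hκ.tendsto_quantile hu01)))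
  refine hlim.congr' ?_
  filter_upwards [hK, hL] with n hKn hLn
  have hX := MemLp.integrable hp'.le ⟨hKn.1, hKn.2.trans_lt ENNReal.coe_lt_top⟩
  have hY := MemLp.integrable hp'.le ⟨hLn.1, hLn.2.trans_lt ENNReal.coe_lt_top⟩
  rw [centering_eq_setIntegral_indicator, lStat, ← integral_sub hX hY]
  rfl

/-! ### Kernel smoothing -/

/-- The law of `X + b Z` for independent `X ∼ ν` and `Z ∼ κ`, that is, the kernel smoothing of `ν`
with bandwidth `b`. -/
def smoothedMeasure (ν κ : Measure ℝ) (b : ℝ) : Measure ℝ :=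
  (ν.prod κ).map fun p => p.1 + b * p.2

section smoothedMeasure

variable {ν κ : Measure ℝ} {b : ℝ}

instance [IsProbabilityMeasure ν] [IsProbabilityMeasure κ] :
    IsProbabilityMeasure (smoothedMeasure ν κ b) :=
  Measure.isProbabilityMeasure_map (by fun_prop)

theorem measureReal_mul_le_smoothedMeasure [IsProbabilityMeasure ν] [IsProbabilityMeasure κ]
    {A B S : Set ℝ} (hS : MeasurableSet S) (h : ∀ x ∈ A, ∀ z ∈ B, x + b * z ∈ S) :
    ν.real A * κ.real B ≤ (smoothedMeasure ν κ b).real S := by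
  rw [smoothedMeasure, map_measureReal_apply (by fun_prop) hS, ← measureReal_prod_prod]
  exact measureReal_mono fun p hp => h p.1 hp.1 p.2 hp.2

theorem measureReal_Iic_mul_le_smoothedMeasure [IsProbabilityMeasure ν] [IsProbabilityMeasure κ]
    (hb : 0 < b) (s t : ℝ) :
    ν.real (Iic s) * κ.real (Iic ((t - s) / b)) ≤ (smoothedMeasure ν κ b).real (Iic t) :=
  measureReal_mul_le_smoothedMeasure measurableSet_Iic fun x hx z hz => by
    have hz' := (le_div_iff₀' hb).1 (mem_Iic.1 hz)
    exact mem_Iic.2 (by linarith [mem_Iic.1 hx])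

theorem measureReal_Ioi_mul_le_smoothedMeasure [IsProbabilityMeasure ν] [IsProbabilityMeasure κ]
    (hb : 0 < b) (s t : ℝ) :
    ν.real (Ioi s) * κ.real (Ioi ((t - s) / b)) ≤ (smoothedMeasure ν κ b).real (Ioi t) :=
  measureReal_mul_le_smoothedMeasure measurableSet_Ioi fun x hx z hz => by
    have hz' := (div_lt_iff₀' hb).1 (mem_Ioi.1 hz)
    exact mem_Ioi.2 (by linarith [mem_Ioi.1 hx])

end smoothedMeasure

theorem measureReal_Ioi_eq (κ : Measure ℝ) [IsProbabilityMeasure κ] (t : ℝ) :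
    κ.real (Ioi t) = 1 - κ.real (Iic t) := by
  rw [← compl_Iic, probReal_compl_eq_one_sub measurableSet_Iic]

theorem tendsto_measureReal_Iic_atTop (κ : Measure ℝ) [IsProbabilityMeasure κ] :
    Tendsto (fun t => κ.real (Iic t)) atTop (𝓝 1) :=
  (tendsto_cdf_atTop κ).congr (cdf_eq_real κ)

theorem tendsto_measureReal_Ioi_atBot (κ : Measure ℝ) [IsProbabilityMeasure κ] :
    Tendsto (fun t => κ.real (Ioi t)) atBot (𝓝 1) := by
  simp only [measureReal_Ioi_eq, ← cdf_eq_real]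
  simpa using (tendsto_cdf_atBot κ).const_sub 1

namespace AsympUniform

variable {ν : ℕ → Measure ℝ} {r : ℝ} {κ : Measure ℝ} [IsProbabilityMeasure κ] {b : ℕ → ℝ}

theorem tendsto_smoothed_Iic (h : AsympUniform ν r) (hb : ∀ᶠ n in atTop, 0 < b n)
    (hb0 : Tendsto b atTop (𝓝 0)) {q : ℚ} (hq : (q : ℝ) ∈ Ioo (0 : ℝ) 1) :
    Tendsto (fun n => (smoothedMeasure (ν n) κ (b n)).real (Iic (q : ℝ))) atTop (𝓝 q) := by
  have hinv : Tendsto (fun n => (b n)⁻¹) atTop atTop :=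
    tendsto_inv_nhdsGT_zero.comp (tendsto_nhdsWithin_iff.2 ⟨hb0, hb⟩)
  rw [tendsto_order]
  constructor
  · intro a ha
    obtain ⟨s, has, hsq⟩ := exists_rat_btwn (max_lt ha hq.1)
    obtain ⟨has, hs0⟩ := max_lt_iff.1 has
    have hlim : Tendsto (fun n => (ν n).real (Iic (s : ℝ)) * κ.real (Iic ((q - s) / b n)))
        atTop (𝓝 (s * 1)) :=
      (h.tendsto_Iic s ⟨hs0, hsq.trans hq.2⟩).mul
        ((tendsto_measureReal_Iic_atTop κ).comp (hinv.const_mul_atTop (sub_pos.2 hsq)))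
    filter_upwards [hlim.eventually_const_lt (u := a) (by linarith), hb, h.isProbabilityMeasure]
      with n hn hbn _
    exact hn.trans_le (measureReal_Iic_mul_le_smoothedMeasure hbn _ _)
  · intro a ha
    obtain ⟨s, hqs, hsa⟩ := exists_rat_btwn (lt_min ha hq.2)
    obtain ⟨hsa, hs1⟩ := lt_min_iff.1 hsa
    have hlim : Tendsto (fun n => (1 - (ν n).real (Iic (s : ℝ))) * κ.real (Ioi ((q - s) / b n)))
        atTop (𝓝 ((1 - s) * 1)) :=
      ((h.tendsto_Iic s ⟨hq.1.trans hqs, hs1⟩).const_sub 1).mul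
        ((tendsto_measureReal_Ioi_atBot κ).comp
          (hinv.const_mul_atTop_of_neg (sub_neg.2 hqs)))
    filter_upwards [hlim.eventually_const_lt (u := 1 - a) (by linarith), hb,
      h.isProbabilityMeasure] with n hn hbn _
    have hle := measureReal_Ioi_mul_le_smoothedMeasure (ν := ν n) (κ := κ) hbn s q
    rw [measureReal_Ioi_eq, measureReal_Ioi_eq (smoothedMeasure _ _ _)] at hle
    linarith

theorem smoothed_tail_le (h : AsympUniform ν r) (hb : ∀ᶠ n in atTop, 0 < b n)
    (hκ_left : 0 < κ.real (Iic 0)) (hκ_right : 0 < κ.real (Ici 0)) :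
    ∃ C : ℝ, 0 < C ∧ ∀ᶠ n : ℕ in atTop, ∀ t ∈ Ioo (0 : ℝ) 1,
      t ^ r ≤ C * max ((smoothedMeasure (ν n) κ (b n)).real (Iio t)) (1 / n) ∧
        (1 - t) ^ r ≤ C * max ((smoothedMeasure (ν n) κ (b n)).real (Ioi t)) (1 / n) := by
  obtain ⟨C, hC, htail⟩ := h.tail_le
  set a : ℝ := min (κ.real (Iic 0)) (κ.real (Ici 0))
  have ha : 0 < a := lt_min hκ_left hκ_right
  have ha1 : a ≤ 1 := min_le_of_left_le measureReal_le_one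
  have hscale {x y : ℝ} {n : ℕ} (hxy : x * a ≤ y) :
      C * max x (1 / n) ≤ C / a * max y (1 / n) := by
    rw [div_mul_eq_mul_div, le_div_iff₀ ha, mul_assoc, max_mul_of_nonneg _ _ ha.le]
    gcongr
    exact mul_le_of_le_one_right (by positivity) ha1
  refine ⟨C / a, by positivity, ?_⟩
  filter_upwards [htail, hb, h.isProbabilityMeasure] with n hn hbn _ t ht
  refine (hn t ht).imp (fun hle => hle.trans (hscale ?_)) (fun hle => hle.trans (hscale ?_))
  · refine (mul_le_mul_of_nonneg_left (min_le_left _ _) measureReal_nonneg).trans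
      (measureReal_mul_le_smoothedMeasure measurableSet_Iio fun x hx z hz => ?_)
    exact mem_Iio.2 (by linarith [mem_Iio.1 hx, mul_nonpos_of_nonneg_of_nonpos hbn.le hz])
  · refine (mul_le_mul_of_nonneg_left (min_le_right _ _) measureReal_nonneg).trans
      (measureReal_mul_le_smoothedMeasure measurableSet_Ioi fun x hx z hz => ?_)
    exact mem_Ioi.2 (by linarith [mem_Ioi.1 hx, mul_nonneg hbn.le hz])

theorem smoothed (h : AsympUniform ν r) (hb : ∀ᶠ n in atTop, 0 < b n)
    (hb0 : Tendsto b atTop (𝓝 0)) (hκ_left : 0 < κ.real (Iic 0))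
    (hκ_right : 0 < κ.real (Ici 0)) :
    AsympUniform (fun n => smoothedMeasure (ν n) κ (b n)) r where
  isProbabilityMeasure := h.isProbabilityMeasure.mono fun _ _ => inferInstance
  tendsto_Iic _ hq := h.tendsto_smoothed_Iic hb hb0 hq
  tail_le := h.smoothed_tail_le hb hκ_left hκ_right

end AsympUniform

/-! ### Empirical measures of a uniform sample -/

section Chernoff

variable {Ω : Type*} [MeasurableSpace Ω] {P : Measure Ω} [IsProbabilityMeasure P]

theorem exp_mul_le_of_mem_Icc {x : ℝ} (hx : x ∈ Icc (0 : ℝ) 1) (t : ℝ) :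
    Real.exp (t * x) ≤ 1 + (Real.exp t - 1) * x := by
  have h := convexOn_exp.2 (mem_univ 0) (mem_univ t) (sub_nonneg.2 hx.2) hx.1 (by ring)
  simp only [smul_eq_mul, mul_zero, zero_add, Real.exp_zero] at h
  rw [mul_comm t]
  linarith

theorem mgf_le_exp_of_mem_Icc {X : Ω → ℝ} (hX : AEMeasurable X P)
    (h01 : ∀ᵐ ω ∂P, X ω ∈ Icc (0 : ℝ) 1) (t : ℝ) :
    mgf X P t ≤ Real.exp ((Real.exp t - 1) * ∫ ω, X ω ∂P) := by
  have hint : Integrable X P := Integrable.of_mem_Icc 0 1 hX h01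
  calc mgf X P t ≤ ∫ ω, (1 + (Real.exp t - 1) * X ω) ∂P :=
        integral_mono_ae (integrable_exp_mul_of_mem_Icc hX h01)
          ((integrable_const 1).add (hint.const_mul _))
          (h01.mono fun ω hω => exp_mul_le_of_mem_Icc hω t)
    _ = (Real.exp t - 1) * ∫ ω, X ω ∂P + 1 := by
        rw [integral_add (integrable_const 1) (hint.const_mul _), integral_const_mul]
        simp [add_comm]
    _ ≤ _ := Real.add_one_le_exp _

variable {ι : Type*} {X : ι → Ω → ℝ} (hX : ∀ i, Measurable (X i)) (hind : iIndepFun X P)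
  (h01 : ∀ i ω, X i ω ∈ Icc (0 : ℝ) 1) (s : Finset ι)

include hX h01 in
theorem integrable_exp_mul_sum (t : ℝ) :
    Integrable (fun ω => Real.exp (t * (∑ i ∈ s, X i) ω)) P := by
  refine integrable_exp_mul_of_mem_Icc (a := 0) (b := s.card) (by fun_prop)
    (Eventually.of_forall fun ω => ?_)
  rw [Finset.sum_apply]
  refine ⟨Finset.sum_nonneg fun i _ => (h01 i ω).1, ?_⟩
  simpa using Finset.sum_le_sum fun i (_ : i ∈ s) => (h01 i ω).2

include hX hind h01 in
theorem mgf_sum_le_exp (t : ℝ) :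
    mgf (∑ i ∈ s, X i) P t ≤ Real.exp ((Real.exp t - 1) * ∑ i ∈ s, ∫ ω, X i ω ∂P) := by
  rw [hind.mgf_sum hX, Finset.mul_sum, Real.exp_sum]
  exact Finset.prod_le_prod (fun _ _ => mgf_nonneg) fun i _ =>
    mgf_le_exp_of_mem_Icc (hX i).aemeasurable (Eventually.of_forall (h01 i)) t

include hX hind h01 in
theorem measureReal_sum_le_quarter_le_exp :
    P.real {ω | ∑ i ∈ s, X i ω ≤ (∑ i ∈ s, ∫ ω, X i ω ∂P) / 4} ≤
      Real.exp (-((∑ i ∈ s, ∫ ω, X i ω ∂P) / 4)) := by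
  set m : ℝ := ∑ i ∈ s, ∫ ω, X i ω ∂P
  have hm : 0 ≤ m := Finset.sum_nonneg fun i _ => integral_nonneg fun ω => (h01 i ω).1
  have hexp : Real.exp (-1) ≤ 1 / 2 := Real.exp_neg_one_lt_half.le
  have h := measure_le_le_exp_mul_mgf (m / 4) (by norm_num : (-1 : ℝ) ≤ 0)
    (integrable_exp_mul_sum hX h01 s (-1) (P := P))
  simp only [Finset.sum_apply] at h
  calc _ ≤ Real.exp (- -1 * (m / 4)) * mgf (∑ i ∈ s, X i) P (-1) := h
    _ ≤ Real.exp (- -1 * (m / 4)) * Real.exp ((Real.exp (-1) - 1) * m) := by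
        gcongr
        exact mgf_sum_le_exp hX hind h01 s (-1)
    _ ≤ Real.exp (-(m / 4)) := by
        rw [← Real.exp_add, Real.exp_le_exp]
        nlinarith

include hX hind h01 in
theorem measureReal_three_mul_le_sum_le_exp {m : ℝ} (hm : ∑ i ∈ s, ∫ ω, X i ω ∂P ≤ m) :
    P.real {ω | 3 * m ≤ ∑ i ∈ s, X i ω} ≤ Real.exp (-m) := by
  have : 0 ≤ m :=
    (Finset.sum_nonneg fun i _ => integral_nonneg fun ω => (h01 i ω).1).trans hm
  have h := measure_ge_le_exp_mul_mgf (3 * m) zero_le_one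
    (integrable_exp_mul_sum hX h01 s 1 (P := P))
  simp only [Finset.sum_apply] at h
  calc _ ≤ Real.exp (-1 * (3 * m)) * mgf (∑ i ∈ s, X i) P 1 := h
    _ ≤ Real.exp (-1 * (3 * m)) * Real.exp ((Real.exp 1 - 1) * ∑ i ∈ s, ∫ ω, X i ω ∂P) := by
        gcongr
        exact mgf_sum_le_exp hX hind h01 s 1
    _ ≤ Real.exp (-m) := by
        rw [← Real.exp_add, Real.exp_le_exp]
        have he : (Real.exp 1 - 1) * ∑ i ∈ s, ∫ ω, X i ω ∂P ≤ 2 * m :=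
          mul_le_mul (by linarith [Real.exp_one_lt_three]) hm
            (Finset.sum_nonneg fun i _ => integral_nonneg fun ω => (h01 i ω).1) zero_le_two
        linarith

end Chernoff

theorem summable_rpow_mul_exp_neg_mul_rpow (s : ℝ) {c a : ℝ} (hc : 0 < c) (ha : 0 < a) :
    Summable fun n : ℕ => (n : ℝ) ^ s * Real.exp (-c * (n : ℝ) ^ a) := by
  have hexp := (isLittleO_exp_neg_mul_rpow_atTop hc ((-s - 2) / a)).isBigO.comp_tendsto
    ((tendsto_rpow_atTop ha).comp tendsto_natCast_atTop_atTop)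
  refine summable_of_isBigO_nat (Real.summable_nat_rpow.2 (by norm_num : (-2 : ℝ) < -1))
    (((Asymptotics.isBigO_refl (fun n : ℕ => (n : ℝ) ^ s) atTop).mul hexp).trans_eventuallyEq ?_)
  filter_upwards [eventually_gt_atTop 0] with n hn
  have hn0 : (0 : ℝ) < n := by exact_mod_cast hn
  simp only [Function.comp_apply]
  rw [← Real.rpow_mul hn0.le, mul_div_cancel₀ _ ha.ne', ← Real.rpow_add hn0]
  ring_nf

theorem ae_eventually_notMem_of_measureReal_le {Ω : Type*} [MeasurableSpace Ω] {P : Measure Ω}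
    [IsFiniteMeasure P] {s : ℕ → Set Ω} {f : ℕ → ℝ} (hf : Summable f)
    (h : ∀ᶠ n in atTop, P.real (s n) ≤ f n) : ∀ᵐ ω ∂P, ∀ᶠ n in atTop, ω ∉ s n := by
  have hs : Summable fun n => P.real (s n) :=
    hf.of_norm_bounded_eventually_nat (h.mono fun n hn => by
      rwa [Real.norm_of_nonneg measureReal_nonneg])
  exact ae_eventually_notMem
    ((tsum_congr fun n => (ofReal_measureReal (s := s n)).symm).trans_ne hs.tsum_ofReal_ne_top)

/-- The empirical measure `n⁻¹ ∑_{i < n} δ_{x i}` of the first `n` points of `x`. Its cumulative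
distribution function is the empirical distribution function of the sample. It is the zero measure
for `n = 0`. -/
def empiricalMeasure (x : ℕ → ℝ) (n : ℕ) : Measure ℝ :=
  (n : ℝ≥0∞)⁻¹ • ∑ i ∈ Finset.range n, Measure.dirac (x i)

theorem isProbabilityMeasure_empiricalMeasure (x : ℕ → ℝ) {n : ℕ} (hn : n ≠ 0) :
    IsProbabilityMeasure (empiricalMeasure x n) :=
  ⟨by simp [empiricalMeasure, ENNReal.inv_mul_cancel, hn]⟩

theorem lintegral_empiricalMeasure (x : ℕ → ℝ) (n : ℕ) (φ : ℝ → ℝ≥0∞) :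
    ∫⁻ t, φ t ∂empiricalMeasure x n = (n : ℝ≥0∞)⁻¹ * ∑ i ∈ Finset.range n, φ (x i) := by
  simp [empiricalMeasure, lintegral_finsetSum_measure]

theorem integral_empiricalMeasure (x : ℕ → ℝ) (n : ℕ) (φ : ℝ → ℝ) :
    ∫ t, φ t ∂empiricalMeasure x n = (∑ i ∈ Finset.range n, φ (x i)) / n := by
  rw [empiricalMeasure, integral_smul_measure, integral_finsetSum_measure fun i _ =>
    integrable_dirac (by simp)]
  simp [div_eq_inv_mul]

theorem lintegral_empiricalMeasure_eq_ofReal (x : ℕ → ℝ) {n : ℕ} (hn : n ≠ 0) {φ : ℝ → ℝ≥0∞}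
    (hφ : ∀ t, φ t ≠ ∞) :
    ∫⁻ t, φ t ∂empiricalMeasure x n =
      ENNReal.ofReal (∫ t, (φ t).toReal ∂empiricalMeasure x n) := by
  rw [lintegral_empiricalMeasure, integral_empiricalMeasure, ← ENNReal.toReal_sum fun i _ => hφ _,
    ENNReal.ofReal_div_of_pos (by positivity), ENNReal.ofReal_natCast,
    ENNReal.ofReal_toReal (ENNReal.sum_ne_top.2 fun i _ => hφ _), ENNReal.div_eq_inv_mul]

theorem measureReal_empiricalMeasure (x : ℕ → ℝ) (n : ℕ) {s : Set ℝ} (hs : MeasurableSet s) :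
    (empiricalMeasure x n).real s = (∑ i ∈ Finset.range n, s.indicator 1 (x i)) / n := by
  rw [← integral_indicator_one hs, integral_empiricalMeasure]

theorem measureReal_empiricalMeasure_one_sub (x : ℕ → ℝ) (n : ℕ) (t : ℝ) :
    (empiricalMeasure (fun i => 1 - x i) n).real (Iio (1 - t)) =
      (empiricalMeasure x n).real (Ioi t) := by
  simp [measureReal_empiricalMeasure, measurableSet_Iio, measurableSet_Ioi, indicator_apply]

section Sampling

variable {Ω : Type*} [MeasurableSpace Ω] {P : Measure Ω} {ξ : ℕ → Ω → ℝ} {ν : Measure ℝ}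

theorem ae_tendsto_integral_empiricalMeasure (hm : ∀ i, Measurable (ξ i)) (hind : iIndepFun ξ P)
    (hν : ∀ i, P.map (ξ i) = ν) {φ : ℝ → ℝ} (hφ : Measurable φ) (hφi : Integrable φ ν) :
    ∀ᵐ ω ∂P, Tendsto (fun n => ∫ t, φ t ∂empiricalMeasure (fun i => ξ i ω) n) atTop
      (𝓝 (∫ t, φ t ∂ν)) := by
  simp_rw [integral_empiricalMeasure]
  rw [← hν 0] at hφi ⊢
  rw [integral_map (hm 0).aemeasurable hφ.aestronglyMeasurable]
  refine strong_law_ae_real (fun i ω => φ (ξ i ω)) (hφi.comp_measurable (hm 0))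
    (fun i j hij => (hind.indepFun hij).comp hφ hφ) fun i => ?_
  exact IdentDistrib.comp ⟨(hm i).aemeasurable, (hm 0).aemeasurable, (hν i).trans (hν 0).symm⟩ hφ

theorem ae_exists_eventually_lintegral_empiricalMeasure_le (hm : ∀ i, Measurable (ξ i))
    (hind : iIndepFun ξ P) (hν : ∀ i, P.map (ξ i) = ν) {φ : ℝ → ℝ≥0∞} (hφ : Measurable φ)
    (hφ_top : ∀ t, φ t ≠ ∞) (hφi : ∫⁻ t, φ t ∂ν ≠ ∞) :
    ∀ᵐ ω ∂P, ∃ A : ℝ≥0, ∀ᶠ n in atTop,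
      ∫⁻ t, φ t ∂empiricalMeasure (fun i => ξ i ω) n ≤ A := by
  filter_upwards [ae_tendsto_integral_empiricalMeasure hm hind hν hφ.ennreal_toReal
    (integrable_toReal_of_lintegral_ne_top hφ.aemeasurable hφi)] with ω hω
  refine ⟨Real.toNNReal (∫ t, (φ t).toReal ∂ν + 1), ?_⟩
  filter_upwards [hω.eventually_lt_const (lt_add_one _), eventually_ne_atTop 0] with n hn hn0
  rw [lintegral_empiricalMeasure_eq_ofReal _ hn0 hφ_top]
  exact ENNReal.ofReal_le_ofReal hn.le

theorem measureReal_empiricalMeasure_le_quarter_le_exp [IsProbabilityMeasure P]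
    (hm : ∀ i, Measurable (ξ i)) (hind : iIndepFun ξ P) (hν : ∀ i, P.map (ξ i) = ν)
    {s : Set ℝ} (hs : MeasurableSet s) (n : ℕ) :
    P.real {ω | (empiricalMeasure (fun i => ξ i ω) n).real s ≤ ν.real s / 4} ≤
      Real.exp (-(n * ν.real s / 4)) := by
  have hφ : Measurable (s.indicator (1 : ℝ → ℝ)) := measurable_one.indicator hs
  have hmean (i : ℕ) : ∫ ω, s.indicator (1 : ℝ → ℝ) (ξ i ω) ∂P = ν.real s := by
    rw [← integral_map (hm i).aemeasurable hφ.aestronglyMeasurable, hν i,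
      integral_indicator_one hs]
  have h := measureReal_sum_le_quarter_le_exp (fun i => hφ.comp (hm i))
    (hind.comp (fun _ => _) fun _ => hφ)
    (fun i ω => by by_cases h : ξ i ω ∈ s <;> simp [h]) (Finset.range n)
  simp only [Function.comp_apply, hmean, Finset.sum_const, Finset.card_range, nsmul_eq_mul] at h
  refine le_trans (measureReal_mono fun ω hω => ?_) h
  rcases eq_or_ne n 0 with rfl | hn
  · simp
  · have hn0 : (0 : ℝ) < n := by positivity
    rw [mem_ofPred_eq, measureReal_empiricalMeasure _ _ hs, div_le_iff₀ hn0] at hω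
    exact hω.trans_eq (by ring)

theorem measureReal_uniform_Iio {t : ℝ} (ht : t ∈ Icc (0 : ℝ) 1) :
    (volume.restrict (Ioo (0 : ℝ) 1)).real (Iio t) = t := by
  rw [measureReal_restrict_apply measurableSet_Iio, inter_comm, Ioo_inter_Iio, min_eq_right ht.2,
    Real.volume_real_Ioo_of_le ht.1, sub_zero]

theorem map_one_sub_uniform :
    (volume.restrict (Ioo (0 : ℝ) 1)).map (fun t => 1 - t) = volume.restrict (Ioo 0 1) := by
  simpa using ((Measure.measurePreserving_sub_left volume (1 : ℝ)).restrict_preimage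
    (measurableSet_Ioo (a := (0 : ℝ)) (b := 1))).map_eq

theorem ae_eventually_lt_empiricalMeasure_Iio_grid [IsProbabilityMeasure P]
    (hm : ∀ i, Measurable (ξ i)) (hind : iIndepFun ξ P)
    (hu : ∀ i, P.map (ξ i) = volume.restrict (Ioo (0 : ℝ) 1)) {a : ℝ} (ha : 0 < a) :
    ∀ᵐ ω ∂P, ∀ᶠ n : ℕ in atTop, ∀ j ≤ n, (n : ℝ) ^ a ≤ j →
      (j / n : ℝ) / 4 < (empiricalMeasure (fun i => ξ i ω) n).real (Iio (j / n : ℝ)) := by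
  set bad : ℕ → ℕ → Set Ω := fun n j =>
    {ω | (empiricalMeasure (fun i => ξ i ω) n).real (Iio (j / n : ℝ)) ≤ (j / n : ℝ) / 4}
  have hbad {n j : ℕ} (hj : j ≤ n) (hja : (n : ℝ) ^ a ≤ j) :
      P.real (bad n j) ≤ Real.exp (-(1 / 4) * (n : ℝ) ^ a) := by
    have hjn : (j / n : ℝ) ∈ Icc (0 : ℝ) 1 :=
      ⟨by positivity, div_le_one_of_le₀ (by exact_mod_cast hj) (by positivity)⟩
    have h := measureReal_empiricalMeasure_le_quarter_le_exp hm hind hu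
      (measurableSet_Iio (a := (j / n : ℝ))) n
    rw [measureReal_uniform_Iio hjn, mul_div_cancel_of_imp' fun h => by simp_all] at h
    exact h.trans (Real.exp_le_exp.2 (by linarith))
  have hunion (n : ℕ) : P.real (⋃ j ∈ (Finset.range (n + 1)).filter fun j : ℕ => (n : ℝ) ^ a ≤ j,
      bad n j) ≤ (n + 1) * Real.exp (-(1 / 4) * (n : ℝ) ^ a) := by
    refine (measureReal_biUnion_finset_le _ _).trans ((Finset.sum_le_card_nsmul _ _
      (Real.exp (-(1 / 4) * (n : ℝ) ^ a)) fun j hj => ?_).trans ?_)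
    · rw [Finset.mem_filter, Finset.mem_range] at hj
      exact hbad (by lia) hj.2
    · rw [nsmul_eq_mul]
      gcongr
      exact_mod_cast (Finset.card_filter_le _ _).trans_eq (Finset.card_range _)
  have hsum : Summable fun n : ℕ => ((n : ℝ) + 1) * Real.exp (-(1 / 4) * (n : ℝ) ^ a) := by
    have h (s : ℝ) := summable_rpow_mul_exp_neg_mul_rpow s (by norm_num : (0 : ℝ) < 1 / 4) ha
    simpa [add_mul] using (h 1).add (h 0)
  filter_upwards [ae_eventually_notMem_of_measureReal_le hsum (Eventually.of_forall hunion)]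
    with ω hω
  filter_upwards [hω] with n hn j hj hja
  by_contra! h
  exact hn (mem_biUnion (x := j) (by simp [hj, hja]) h)

theorem rpow_le_mul_max_of_grid {F : ℝ → ℝ} (hF : Monotone F) {r : ℝ} (hr : 1 < r) {n : ℕ}
    (hn : n ≠ 0) (hgrid : ∀ j ≤ n, (n : ℝ) ^ (1 - 1 / r) ≤ j → (j / n : ℝ) / 4 < F (j / n))
    {t : ℝ} (ht : t ∈ Ioo (0 : ℝ) 1) : t ^ r ≤ 8 ^ r * max (F t) (1 / n) := by
  have hn0 : (0 : ℝ) < n := by positivity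
  have hr0 : 0 < r := by linarith
  have hr1 : 1 / r < 1 := (div_lt_one hr0).2 hr
  have hna : 1 ≤ (n : ℝ) ^ (1 - 1 / r) :=
    Real.one_le_rpow (by exact_mod_cast Nat.one_le_iff_ne_zero.2 hn) (by linarith)
  have hjle : (⌊n * t⌋₊ : ℝ) ≤ n * t := Nat.floor_le (mul_nonneg hn0.le ht.1.le)
  have hjlt : n * t < ⌊n * t⌋₊ + 1 := Nat.lt_floor_add_one _
  rcases le_or_gt ((n : ℝ) ^ (1 - 1 / r)) ⌊n * t⌋₊ with hj | hj
  · have hjn : ⌊n * t⌋₊ ≤ n := by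
      exact_mod_cast hjle.trans (mul_le_of_le_one_right hn0.le ht.2.le)
    have hlow : t / 8 ≤ F t :=
      calc t / 8 ≤ (⌊n * t⌋₊ / n : ℝ) / 4 := by
            rw [div_div, div_le_div_iff₀ (by norm_num) (by positivity)]
            linarith
        _ ≤ F (⌊n * t⌋₊ / n) := (hgrid _ hjn hj).le
        _ ≤ F t := hF (by rwa [div_le_iff₀' hn0])
    calc t ^ r ≤ t := Real.rpow_le_self_of_le_one ht.1.le ht.2.le hr.le
      _ ≤ 8 * F t := by linarith
      _ ≤ 8 ^ r * max (F t) (1 / n) := by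
        gcongr
        · linarith [ht.1]
        · exact Real.self_le_rpow_of_one_le (by norm_num) hr.le
        · exact le_max_left _ _
  · have hsmall : t ≤ 8 * (n : ℝ) ^ (-(1 / r)) := by
      refine le_of_mul_le_mul_left ?_ hn0
      rw [mul_left_comm, ← Real.rpow_one_add' hn0.le (by linarith), ← sub_eq_add_neg]
      linarith
    calc t ^ r ≤ (8 * (n : ℝ) ^ (-(1 / r))) ^ r := Real.rpow_le_rpow ht.1.le hsmall hr0.le
      _ = 8 ^ r * (1 / n) := by
        rw [Real.mul_rpow (by norm_num) (by positivity), ← Real.rpow_mul hn0.le,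
          show -(1 / r) * r = -1 by field_simp, Real.rpow_neg_one, one_div]
      _ ≤ 8 ^ r * max (F t) (1 / n) := by gcongr; exact le_max_right _ _

theorem ae_eventually_rpow_le_mul_max_empiricalMeasure_Iio [IsProbabilityMeasure P]
    (hm : ∀ i, Measurable (ξ i)) (hind : iIndepFun ξ P)
    (hu : ∀ i, P.map (ξ i) = volume.restrict (Ioo (0 : ℝ) 1)) {r : ℝ} (hr : 1 < r) :
    ∀ᵐ ω ∂P, ∀ᶠ n : ℕ in atTop, ∀ t ∈ Ioo (0 : ℝ) 1,
      t ^ r ≤ 8 ^ r * max ((empiricalMeasure (fun i => ξ i ω) n).real (Iio t)) (1 / n) := by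
  have ha : 0 < 1 - 1 / r := sub_pos.2 ((div_lt_one (by linarith)).2 hr)
  filter_upwards [ae_eventually_lt_empiricalMeasure_Iio_grid hm hind hu ha] with ω hω
  filter_upwards [hω, eventually_ne_atTop 0] with n hn hn0 t ht
  have := isProbabilityMeasure_empiricalMeasure (fun i => ξ i ω) hn0
  exact rpow_le_mul_max_of_grid (fun s t hst => measureReal_mono (Iio_subset_Iio hst)) hr hn0 hn ht

theorem ae_tendsto_empiricalMeasure_Iic [IsProbabilityMeasure P]
    (hm : ∀ i, Measurable (ξ i)) (hind : iIndepFun ξ P)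
    (hu : ∀ i, P.map (ξ i) = volume.restrict (Ioo (0 : ℝ) 1)) {t : ℝ} (ht : t ∈ Ioo (0 : ℝ) 1) :
    ∀ᵐ ω ∂P, Tendsto (fun n => (empiricalMeasure (fun i => ξ i ω) n).real (Iic t)) atTop
      (𝓝 t) := by
  have h := ae_tendsto_integral_empiricalMeasure hm hind hu
    (measurable_one.indicator (measurableSet_Iic (a := t)))
    ((integrable_const (1 : ℝ)).indicator measurableSet_Iic)
  simp only [integral_indicator_one measurableSet_Iic] at h
  rwa [measureReal_congr Iio_ae_eq_Iic.symm, measureReal_uniform_Iio ⟨ht.1.le, ht.2.le⟩] at h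

theorem ae_asympUniform_empiricalMeasure [IsProbabilityMeasure P]
    (hm : ∀ i, Measurable (ξ i)) (hind : iIndepFun ξ P)
    (hu : ∀ i, P.map (ξ i) = volume.restrict (Ioo (0 : ℝ) 1)) {r : ℝ} (hr : 1 < r) :
    ∀ᵐ ω ∂P, AsympUniform (empiricalMeasure fun i => ξ i ω) r := by
  have hcdf : ∀ᵐ ω ∂P, ∀ q : ℚ, (q : ℝ) ∈ Ioo (0 : ℝ) 1 →
      Tendsto (fun n => (empiricalMeasure (fun i => ξ i ω) n).real (Iic (q : ℝ))) atTop (𝓝 q) :=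
    ae_all_iff.2 fun q => eventually_imp_distrib_left.2 fun hq =>
      ae_tendsto_empiricalMeasure_Iic hm hind hu hq
  have hsub : Measurable fun t : ℝ => 1 - t := measurable_id.const_sub 1
  have hright := ae_eventually_rpow_le_mul_max_empiricalMeasure_Iio (fun i => hsub.comp (hm i))
    (hind.comp (fun _ => _) fun _ => hsub)
    (fun i => by rw [← Measure.map_map hsub (hm i), hu, map_one_sub_uniform]) hr
  filter_upwards [hcdf, ae_eventually_rpow_le_mul_max_empiricalMeasure_Iio hm hind hu hr, hright]
    with ω hcdf hleft hright
  refine ⟨?_, hcdf, 8 ^ r, by positivity, ?_⟩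
  · filter_upwards [eventually_ne_atTop 0] with n hn
    exact isProbabilityMeasure_empiricalMeasure _ hn
  · filter_upwards [hleft, hright] with n hl hr t ht
    have h := hr (1 - t) ⟨by linarith [ht.2], by linarith [ht.1]⟩
    simp only [Function.comp_apply, measureReal_empiricalMeasure_one_sub] at h
    exact ⟨hl t ht, h⟩

end Sampling

/-! ### Moments of the smoothed empirical measure -/

section Sampling

variable {Ω : Type*} [MeasurableSpace Ω] {P : Measure Ω} [IsProbabilityMeasure P]
  {ξ : ℕ → Ω → ℝ} {ν : Measure ℝ}

theorem measureReal_three_mul_le_integral_empiricalMeasure_le_exp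
    (hm : ∀ i, Measurable (ξ i)) (hind : iIndepFun ξ P) (hν : ∀ i, P.map (ξ i) = ν)
    {φ : ℝ → ℝ} (hφ : Measurable φ) {B I : ℝ} (hB : 0 < B) (hφB : ∀ t, φ t ∈ Icc 0 B)
    (hI : ∫ t, φ t ∂ν ≤ I) {n : ℕ} (hn : n ≠ 0) :
    P.real {ω | 3 * I ≤ ∫ t, φ t ∂empiricalMeasure (fun i => ξ i ω) n} ≤
      Real.exp (-(n * (I / B))) := by
  have hφ' : Measurable fun t => φ t / B := hφ.div_const B
  have hmean : ∑ i ∈ Finset.range n, ∫ ω, φ (ξ i ω) / B ∂P ≤ n * (I / B) := by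
    have h (i : ℕ) : ∫ ω, φ (ξ i ω) / B ∂P ≤ I / B := by
      rw [integral_div, ← integral_map (hm i).aemeasurable hφ.aestronglyMeasurable, hν i]
      gcongr
    simpa using Finset.sum_le_card_nsmul (Finset.range n) _ _ fun i _ => h i
  refine le_trans (measureReal_mono fun ω hω => ?_) (measureReal_three_mul_le_sum_le_exp
    (fun i => hφ'.comp (hm i)) (hind.comp (fun _ => _) fun _ => hφ')
    (fun i ω => ⟨div_nonneg (hφB _).1 hB.le, div_le_one_of_le₀ (hφB _).2 hB.le⟩)
    (Finset.range n) hmean)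
  have hn0 : (0 : ℝ) < n := by positivity
  rw [mem_ofPred_eq, integral_empiricalMeasure, le_div_iff₀ hn0] at hω
  simp only [mem_ofPred_eq, Function.comp_apply]
  rw [← Finset.sum_div, le_div_iff₀ hB]
  refine le_trans (le_of_eq ?_) hω
  field_simp

theorem ae_eventually_integral_empiricalMeasure_lt
    (hm : ∀ i, Measurable (ξ i)) (hind : iIndepFun ξ P) (hν : ∀ i, P.map (ξ i) = ν)
    {φ : ℕ → ℝ → ℝ} (hφ : ∀ n, Measurable (φ n)) (hφ0 : ∀ n t, 0 ≤ φ n t) {K s I : ℝ}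
    (hK : 0 < K) (hs : s < 1) (hφK : ∀ᶠ n : ℕ in atTop, ∀ t, φ n t ≤ K * (n : ℝ) ^ s)
    (hI0 : 0 < I) (hI : ∀ n, ∫ t, φ n t ∂ν ≤ I) :
    ∀ᵐ ω ∂P, ∀ᶠ n in atTop, ∫ t, φ n t ∂empiricalMeasure (fun i => ξ i ω) n < 3 * I := by
  have hsum : Summable fun n : ℕ => Real.exp (-(I / K) * (n : ℝ) ^ (1 - s)) := by
    simpa using summable_rpow_mul_exp_neg_mul_rpow 0 (div_pos hI0 hK) (sub_pos.2 hs)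
  have hbad : ∀ᶠ n in atTop,
      P.real {ω | 3 * I ≤ ∫ t, φ n t ∂empiricalMeasure (fun i => ξ i ω) n} ≤
        Real.exp (-(I / K) * (n : ℝ) ^ (1 - s)) := by
    filter_upwards [hφK, eventually_ne_atTop 0] with n hn hn0
    have hn0' : (0 : ℝ) < n := by positivity
    refine (measureReal_three_mul_le_integral_empiricalMeasure_le_exp hm hind hν (hφ n)
      (by positivity : 0 < K * (n : ℝ) ^ s) (fun t => ⟨hφ0 n t, hn t⟩) (hI n) hn0).trans_eq ?_
    rw [Real.rpow_sub hn0', Real.rpow_one]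
    congr 1
    field_simp
  filter_upwards [ae_eventually_notMem_of_measureReal_le hsum hbad] with ω hω
  exact hω.mono fun n hn => not_le.1 hn

end Sampling

/-- The expectation of `φ (y + b Z)` for `Z ∼ κ`: the kernel smoothing of `φ` with bandwidth `b`,
dual to `smoothedMeasure`. -/
def smoothing (κ : Measure ℝ) (b : ℝ) (φ : ℝ → ℝ≥0∞) (y : ℝ) : ℝ≥0∞ := ∫⁻ z, φ (y + b * z) ∂κ

section smoothing

variable {κ : Measure ℝ} {b : ℝ} {φ : ℝ → ℝ≥0∞}

theorem measurable_smoothing [SFinite κ] (hφ : Measurable φ) : Measurable (smoothing κ b φ) :=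
  Measurable.lintegral_prod_right' (f := fun q : ℝ × ℝ => φ (q.1 + b * q.2))
    (hφ.comp (by fun_prop))

theorem lintegral_smoothedMeasure {ν : Measure ℝ} [SFinite κ] (hφ : Measurable φ) :
    ∫⁻ t, φ t ∂smoothedMeasure ν κ b = ∫⁻ y, smoothing κ b φ y ∂ν := by
  rw [smoothedMeasure, lintegral_map hφ (by fun_prop),
    lintegral_prod (fun q => φ (q.1 + b * q.2)) (hφ.comp (by fun_prop)).aemeasurable]
  rfl

theorem lintegral_smoothing [IsProbabilityMeasure κ] (hφ : Measurable φ) :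
    ∫⁻ y, smoothing κ b φ y = ∫⁻ t, φ t := by
  have h : Measurable fun q : ℝ × ℝ => φ (q.1 + b * q.2) := hφ.comp (by fun_prop)
  simp only [smoothing]
  rw [lintegral_lintegral_swap h.aemeasurable]
  simp [lintegral_add_right_eq_self φ]

theorem smoothing_le_lintegral_rpow [IsProbabilityMeasure κ] {C : ℝ≥0} (hκ : κ ≤ C • volume)
    (hb : 0 < b) {p : ℝ} (hp : 1 ≤ p) (hφ : Measurable φ) (y : ℝ) :
    smoothing κ b φ y ≤ (C * ENNReal.ofReal b⁻¹ * ∫⁻ t, φ t ^ p) ^ (1 / p) := by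
  have hscale : ∫⁻ z, φ (y + b * z) ^ p = ENNReal.ofReal b⁻¹ * ∫⁻ t, φ t ^ p := by
    have hm : Measurable fun t => φ (y + t) ^ p := (hφ.comp (by fun_prop)).pow_const p
    rw [← lintegral_map hm (measurable_const_mul b), Real.map_volume_mul_left hb.ne',
      lintegral_smul_measure, abs_of_pos (inv_pos.2 hb),
      lintegral_add_left_eq_self (fun t => φ t ^ p) y, smul_eq_mul]
  have hm : Measurable fun z => φ (y + b * z) := hφ.comp (by fun_prop)
  calc smoothing κ b φ y ≤ (∫⁻ z, φ (y + b * z) ^ p ∂κ) ^ (1 / p) := by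
        simpa [eLpNorm', smoothing] using
          eLpNorm'_le_eLpNorm'_of_exponent_le one_pos hp κ hm.aestronglyMeasurable
    _ ≤ (C * ENNReal.ofReal b⁻¹ * ∫⁻ t, φ t ^ p) ^ (1 / p) := by
        gcongr
        refine (lintegral_mono' hκ le_rfl).trans_eq ?_
        rw [lintegral_smul_measure, hscale, mul_assoc]
        rfl

theorem smoothing_le_mul_rpow [IsProbabilityMeasure κ] {C : ℝ≥0} (hκ : κ ≤ C • volume) {a : ℝ}
    (ha : 0 < a) {n : ℕ} (hab : a ≤ n * b) {p : ℝ} (hp : 1 ≤ p) (hφ : Measurable φ) (y : ℝ) :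
    smoothing κ b φ y ≤
      (C * ENNReal.ofReal a⁻¹ * ∫⁻ t, φ t ^ p) ^ (1 / p) * (n : ℝ≥0∞) ^ (1 / p) := by
  have hnb : 0 < n * b := ha.trans_le hab
  have hb : 0 < b := pos_of_mul_pos_right hnb n.cast_nonneg
  have hinv : ENNReal.ofReal b⁻¹ ≤ ENNReal.ofReal a⁻¹ * n := by
    rw [← ENNReal.ofReal_natCast, ← ENNReal.ofReal_mul (by positivity)]
    refine ENNReal.ofReal_le_ofReal ?_
    rw [inv_mul_eq_div, inv_le_iff_one_le_mul₀ hb, div_mul_eq_mul_div, one_le_div ha]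
    exact hab
  rw [← ENNReal.mul_rpow_of_nonneg _ _ (by positivity)]
  refine (smoothing_le_lintegral_rpow hκ hb hp hφ y).trans
    (ENNReal.rpow_le_rpow ?_ (by positivity))
  calc C * ENNReal.ofReal b⁻¹ * ∫⁻ t, φ t ^ p
      ≤ C * (ENNReal.ofReal a⁻¹ * n) * ∫⁻ t, φ t ^ p := by gcongr
    _ = C * ENNReal.ofReal a⁻¹ * (∫⁻ t, φ t ^ p) * n := by ring

end smoothing

theorem ae_exists_eventually_lintegral_smoothedMeasure_le {Ω : Type*} [MeasurableSpace Ω]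
    {P : Measure Ω} [IsProbabilityMeasure P] {ξ : ℕ → Ω → ℝ} (hm : ∀ i, Measurable (ξ i))
    (hind : iIndepFun ξ P) {ν κ : Measure ℝ} [IsProbabilityMeasure κ]
    (hν : ∀ i, P.map (ξ i) = ν) (hν_le : ν ≤ volume) {C : ℝ≥0} (hκ : κ ≤ C • volume) {a : ℝ}
    (ha : 0 < a) {b : ℕ → ℝ} (hab : ∀ᶠ n : ℕ in atTop, a ≤ n * b n) {φ : ℝ → ℝ≥0∞}
    (hφ : Measurable φ) (hφ1 : ∫⁻ t, φ t ≠ ∞) {p : ℝ} (hp : 1 < p) (hφp : ∫⁻ t, φ t ^ p ≠ ∞) :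
    ∀ᵐ ω ∂P, ∃ A : ℝ≥0, ∀ᶠ n in atTop,
      ∫⁻ t, φ t ∂smoothedMeasure (empiricalMeasure (fun i => ξ i ω) n) κ (b n) ≤ A := by
  set L : ℝ≥0∞ := (C * ENNReal.ofReal a⁻¹ * ∫⁻ t, φ t ^ p) ^ (1 / p)
  have hL : L ≠ ∞ := ENNReal.rpow_ne_top_of_nonneg (by positivity)
    (ENNReal.mul_ne_top (ENNReal.mul_ne_top ENNReal.coe_ne_top ENNReal.ofReal_ne_top) hφp)
  have hLn (n : ℕ) : L * (n : ℝ≥0∞) ^ (1 / p) ≠ ∞ :=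
    ENNReal.mul_ne_top hL (ENNReal.rpow_ne_top_of_nonneg (by positivity) (ENNReal.natCast_ne_top n))
  have hle : ∀ᶠ n : ℕ in atTop, ∀ y, smoothing κ (b n) φ y ≤ L * (n : ℝ≥0∞) ^ (1 / p) :=
    hab.mono fun n hn y => smoothing_le_mul_rpow hκ ha hn hp.le hφ y
  have hleReal : ∀ᶠ n : ℕ in atTop, ∀ y,
      (smoothing κ (b n) φ y).toReal ≤ (L.toReal + 1) * (n : ℝ) ^ (1 / p) := by
    filter_upwards [hle] with n hn y
    refine (ENNReal.toReal_mono (hLn n) (hn y)).trans ?_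
    rw [ENNReal.toReal_mul, ← ENNReal.toReal_rpow (n : ℝ≥0∞), ENNReal.toReal_natCast]
    gcongr
    exact le_add_of_nonneg_right zero_le_one
  have hmean (n : ℕ) : ∫⁻ y, smoothing κ (b n) φ y ∂ν ≤ ∫⁻ t, φ t :=
    (lintegral_mono' hν_le le_rfl).trans_eq (lintegral_smoothing hφ)
  have hmeanReal (n : ℕ) :
      ∫ y, (smoothing κ (b n) φ y).toReal ∂ν ≤ (∫⁻ t, φ t).toReal + 1 := by
    rw [integral_toReal (measurable_smoothing hφ).aemeasurable (ae_lt_top (measurable_smoothing hφ)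
      (ne_top_of_le_ne_top hφ1 (hmean n)))]
    exact (ENNReal.toReal_mono hφ1 (hmean n)).trans (le_add_of_nonneg_right zero_le_one)
  filter_upwards [ae_eventually_integral_empiricalMeasure_lt hm hind hν
    (fun n => (measurable_smoothing hφ).ennreal_toReal) (fun n y => ENNReal.toReal_nonneg)
    (by positivity) ((div_lt_one (by positivity)).2 hp) hleReal (by positivity) hmeanReal] with ω hω
  refine ⟨Real.toNNReal (3 * ((∫⁻ t, φ t).toReal + 1)), ?_⟩
  filter_upwards [hω, hle, eventually_ne_atTop 0] with n hn hn_le hn0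
  rw [lintegral_smoothedMeasure hφ, lintegral_empiricalMeasure_eq_ofReal _ hn0 fun y =>
    ne_top_of_le_ne_top (hLn n) (hn_le y)]
  exact ENNReal.ofReal_le_ofReal hn.le

/-! ### The two statistics as integrals of quantile functions -/

/-- The probability measure with density `k` with respect to Lebesgue measure. -/
def kernelMeasure (k : ℝ → ℝ) : Measure ℝ := volume.withDensity fun z => ENNReal.ofReal (k z)

section kernelMeasure

variable {k : ℝ → ℝ}

theorem isProbabilityMeasure_kernelMeasure (hk : ∀ z, 0 ≤ k z) (hk1 : ∫ z, k z = 1) :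
    IsProbabilityMeasure (kernelMeasure k) where
  measure_univ := by
    rw [kernelMeasure, withDensity_apply _ MeasurableSet.univ, setLIntegral_univ,
      ← ofReal_integral_eq_lintegral_ofReal (.of_integral_ne_zero (by simp [hk1])) (ae_of_all _ hk),
      hk1, ENNReal.ofReal_one]

theorem measureReal_kernelMeasure (hk : ∀ z, 0 ≤ k z) (hki : Integrable k) {s : Set ℝ}
    (hs : MeasurableSet s) : (kernelMeasure k).real s = ∫ z in s, k z := by
  rw [kernelMeasure, measureReal_def, withDensity_apply _ hs,
    ← ofReal_integral_eq_lintegral_ofReal hki.integrableOn (ae_of_all _ hk),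
    ENNReal.toReal_ofReal (integral_nonneg hk)]

theorem kernelMeasure_le_smul_volume {C : ℝ} (hC : ∀ z, k z ≤ C) :
    kernelMeasure k ≤ C.toNNReal • volume := by
  change _ ≤ ENNReal.ofReal C • volume
  rw [← withDensity_const]
  exact withDensity_mono (ae_of_all _ fun z => ENNReal.ofReal_le_ofReal (hC z))

end kernelMeasure

theorem setIntegral_Iic_comp_sub_div (k : ℝ → ℝ) {b : ℝ} (hb : 0 < b) (x t : ℝ) :
    ∫ s in Iic t, k ((s - x) / b) = b * kernelCDF k ((t - x) / b) := by
  have hind (s : ℝ) : (Iic t).indicator (fun s => k ((s - x) / b)) s =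
      (Iic ((t - x) / b)).indicator k ((s - x) / b) := by
    simp only [indicator_apply, mem_Iic, div_le_div_iff_of_pos_right hb, sub_le_sub_iff_right]
  rw [← integral_indicator measurableSet_Iic, kernelCDF, ← integral_indicator measurableSet_Iic,
    integral_congr_ae (ae_of_all _ hind),
    integral_sub_right_eq_self (fun s => (Iic ((t - x) / b)).indicator k (s / b)) x,
    Measure.integral_comp_div, abs_of_pos hb, smul_eq_mul]

theorem kernelEstimator_eq (k : ℝ → ℝ) {b : ℝ} (hb : 0 < b) (n : ℕ) (x : ℕ → ℝ) (t : ℝ) :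
    kernelEstimator k b n x t = (∑ i ∈ Finset.range n, kernelCDF k ((t - x i) / b)) / n := by
  simp only [kernelEstimator, setIntegral_Iic_comp_sub_div k hb]
  rw [← Finset.mul_sum]
  field_simp

theorem measureReal_smoothedMeasure_Iic (ν κ : Measure ℝ) [IsProbabilityMeasure ν]
    [IsProbabilityMeasure κ] {b : ℝ} (hb : 0 < b) (t : ℝ) :
    (smoothedMeasure ν κ b).real (Iic t) = ∫ x, κ.real (Iic ((t - x) / b)) ∂ν := by
  have hS : MeasurableSet ((fun p : ℝ × ℝ => p.1 + b * p.2) ⁻¹' Iic t) :=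
    measurableSet_Iic.preimage (by fun_prop)
  have hsection (x : ℝ) :
      Prod.mk x ⁻¹' ((fun p : ℝ × ℝ => p.1 + b * p.2) ⁻¹' Iic t) = Iic ((t - x) / b) := by
    ext z
    simp only [mem_preimage, mem_Iic, le_div_iff₀' hb, le_sub_iff_add_le']
  have hmeas := measurable_measure_prodMk_left (ν := κ) hS
  simp only [hsection] at hmeas
  rw [smoothedMeasure, map_measureReal_apply (by fun_prop) measurableSet_Iic, measureReal_def,
    Measure.prod_apply hS]
  simp only [hsection]
  exact (integral_toReal hmeas.aemeasurable (ae_of_all _ fun x => measure_lt_top κ _)).symm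

theorem cdf_smoothedMeasure_empiricalMeasure {k : ℝ → ℝ} (hk : ∀ z, 0 ≤ k z)
    (hk1 : ∫ z, k z = 1) {b : ℝ} (hb : 0 < b) {n : ℕ} (hn : n ≠ 0) (x : ℕ → ℝ) :
    ⇑(cdf (smoothedMeasure (empiricalMeasure x n) (kernelMeasure k) b)) =
      kernelEstimator k b n x := by
  have := isProbabilityMeasure_empiricalMeasure x hn
  have := isProbabilityMeasure_kernelMeasure hk hk1
  ext t
  simp only [cdf_eq_real, measureReal_smoothedMeasure_Iic _ _ hb, integral_empiricalMeasure,
    measureReal_kernelMeasure hk (.of_integral_ne_zero (by simp [hk1])) measurableSet_Iic,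
    kernelEstimator_eq k hb, kernelCDF]

theorem setIntegral_quantile_mem_eq_lStat (g : ℝ → ℝ) (c : ℕ → ℕ → ℝ) (n : ℕ) (κ : Measure ℝ) :
    ∫ u in {u | u ∈ Ioo (0 : ℝ) 1 ∧ quantile κ u ∈ Ioo (0 : ℝ) 1},
      g (quantile κ u) * scoreFun c n u = lStat g c n κ := by
  have hpre : NullMeasurableSet (quantile κ ⁻¹' Ioo 0 1) (volume.restrict (Ioo 0 1)) :=
    (aemeasurable_quantile κ).nullMeasurable measurableSet_Ioo
  have hset : {u | u ∈ Ioo (0 : ℝ) 1 ∧ quantile κ u ∈ Ioo (0 : ℝ) 1} =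
      quantile κ ⁻¹' Ioo 0 1 ∩ Ioo 0 1 := by
    ext u
    exact and_comm
  rw [hset, ← Measure.restrict_restrict₀ hpre, ← integral_indicator₀ hpre, lStat]
  congr with u
  by_cases hu : quantile κ u ∈ Ioo 0 1 <;> simp [indicator, hu]

theorem kernelStat_eq_lStat {k : ℝ → ℝ} (hk : ∀ z, 0 ≤ k z) (hk1 : ∫ z, k z = 1) {b : ℕ → ℝ}
    {n : ℕ} (hb : 0 < b n) (hn : n ≠ 0) (g : ℝ → ℝ) (c : ℕ → ℕ → ℝ) (x : ℕ → ℝ) :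
    kernelStat k b g c n x =
      lStat g c n (smoothedMeasure (empiricalMeasure x n) (kernelMeasure k) (b n)) := by
  rw [kernelStat, ← cdf_smoothedMeasure_empiricalMeasure hk hk1 hb hn,
    ← setIntegral_quantile_mem_eq_lStat]
  rfl

theorem measureReal_empiricalMeasure_Iic_eq_card_orderStat (x : ℕ → ℝ) (n : ℕ) (t : ℝ) :
    (empiricalMeasure x n).real (Iic t) =
      (Finset.univ.filter fun j : Fin n => orderStat n x j ≤ t).card / n := by
  rw [measureReal_empiricalMeasure x n measurableSet_Iic, Finset.sum_range,
    ← Equiv.sum_comp (Tuple.sort fun j : Fin n => x j)]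
  simp only [indicator_apply, mem_Iic, Pi.one_apply, Finset.sum_boole, orderStat,
    Function.comp_apply]
  congr!

theorem quantile_empiricalMeasure (x : ℕ → ℝ) {n : ℕ} (i : Fin n) {u : ℝ}
    (hu : u ∈ Ioo ((i : ℝ) / n) ((i + 1 : ℝ) / n)) :
    quantile (empiricalMeasure x n) u = orderStat n x i := by
  have hn : (0 : ℝ) < n := by exact_mod_cast i.pos
  have := isProbabilityMeasure_empiricalMeasure x i.pos.ne'
  have hi : (i + 1 : ℝ) ≤ n := by exact_mod_cast i.isLt
  have hu01 : u ∈ Ioo (0 : ℝ) 1 :=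
    ⟨hu.1.trans_le' (by positivity), hu.2.trans_le ((div_le_one hn).2 hi)⟩
  refine eq_of_forall_ge_iff fun t => ?_
  have horder := Tuple.lt_card_le_iff_apply_le_of_monotone (a := t) (j := i)
    (Tuple.monotone_sort fun j : Fin n => x j)
  rw [quantile_le_iff hu01, cdf_eq_real, measureReal_empiricalMeasure_Iic_eq_card_orderStat]
  refine Iff.trans ⟨fun h => ?_, fun h => ?_⟩ horder
  · have h' := (div_lt_div_iff_of_pos_right hn).1 (hu.1.trans_le h)
    exact_mod_cast h'
  · refine hu.2.le.trans (div_le_div_of_nonneg_right ?_ hn.le)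
    exact_mod_cast h

theorem setIntegral_Ioo_eq_sum_of_eqOn_cells {n : ℕ} (hn : n ≠ 0) {f : ℝ → ℝ} {a : Fin n → ℝ}
    (h : ∀ i : Fin n, EqOn f (fun _ => a i) (Ioo (i / n) ((i + 1) / n))) :
    ∫ u in Ioo 0 1, f u = (∑ i, a i) / n := by
  have hcell (i : Fin n) :
      EqOn f (fun _ => a i) (uIoo ((i : ℝ) / n) ((i + 1 : ℕ) / n)) := by
    rw [uIoo_of_le (by gcongr; simp), Nat.cast_succ]
    exact h i
  calc ∫ u in Ioo 0 1, f u
      = ∫ u in ((0 : ℕ) : ℝ) / n..(n : ℝ) / n, f u := by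
        rw [Nat.cast_zero, zero_div, div_self (by exact_mod_cast hn),
          intervalIntegral.integral_of_le zero_le_one, integral_Ioc_eq_integral_Ioo]
    _ = ∑ i ∈ Finset.range n, ∫ u in (i : ℝ) / n..(i + 1 : ℕ) / n, f u :=
        (intervalIntegral.sum_integral_adjacent_intervals (a := fun i : ℕ => (i : ℝ) / n)
          fun i hi => intervalIntegrable_const.congr_uIoo (hcell ⟨i, hi⟩).symm).symm
    _ = ∑ i : Fin n, ∫ u in (i : ℝ) / n..(i + 1 : ℕ) / n, f u := Finset.sum_range _
    _ = ∑ i, a i / n := Finset.sum_congr rfl fun i _ => by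
        rw [intervalIntegral.integral_congr_uIoo (hcell i), intervalIntegral.integral_const,
          smul_eq_mul]
        push_cast
        ring
    _ = (∑ i, a i) / n := (Finset.sum_div ..).symm

theorem scoreFun_of_mem_cell (c : ℕ → ℕ → ℝ) {n i : ℕ} {u : ℝ}
    (hu : u ∈ Ioo ((i : ℝ) / n) ((i + 1) / n)) : scoreFun c n u = c n (i + 1) := by
  have hn : (0 : ℝ) < n := Nat.cast_pos.2 (Nat.pos_of_ne_zero fun h => by simp [h] at hu)
  rw [scoreFun_of_pos (hu.1.trans_le' (by positivity))]
  congr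
  rw [Nat.ceil_eq_iff (Nat.succ_ne_zero i)]
  rw [Nat.succ_sub_one, Nat.cast_succ]
  exact ⟨(div_lt_iff₀' hn).1 hu.1, ((lt_div_iff₀' hn).1 hu.2).le⟩

theorem orderStatSum_eq_lStat (g : ℝ → ℝ) (c : ℕ → ℕ → ℝ) {n : ℕ} (hn : n ≠ 0) {x : ℕ → ℝ}
    (hx : ∀ i, x i ∈ Ioo (0 : ℝ) 1) :
    orderStatSum g c n x = lStat g c n (empiricalMeasure x n) := by
  rw [lStat, orderStatSum, one_div, ← div_eq_inv_mul]
  refine (setIntegral_Ioo_eq_sum_of_eqOn_cells hn fun i u hu => ?_).symm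
  have hmem : orderStat n x i ∈ Ioo 0 1 := hx _
  simp only [quantile_empiricalMeasure x i hu, scoreFun_of_mem_cell c hu, indicator_of_mem hmem]

/-! ### The hypotheses on `g` and `k` -/

theorem tendsto_level : Tendsto level atTop (𝓝 0) :=
  tendsto_const_nhds.div_atTop (tendsto_atTop_add_const_right _ _ tendsto_natCast_atTop_atTop)

theorem eventually_mem_Ioo_level {t : ℝ} (ht : t ∈ Ioo (0 : ℝ) 1) :
    ∀ᶠ m in atTop, t ∈ Ioo (level m) (1 - level m) := by
  filter_upwards [tendsto_level.eventually_lt_const ht.1,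
    tendsto_level.eventually_lt_const (sub_pos.2 ht.2)] with m h₁ h₂
  exact ⟨h₁, lt_sub_comm.1 h₂⟩

theorem freeze_eq {g : ℝ → ℝ} {θ t : ℝ} (ht : t ∈ Ioo θ (1 - θ)) : freeze g θ t = g t := by
  rw [freeze, min_eq_left ht.2.le, max_eq_right ht.1.le]

theorem measurable_of_boundedVariationOn {f : ℝ → ℝ} (hf : BoundedVariationOn f univ) :
    Measurable f := by
  obtain ⟨p, q, hp, hq, rfl⟩ := hf.locallyBoundedVariationOn.exists_monotoneOn_sub_monotoneOn
  exact (monotoneOn_univ.1 hp).measurable.sub (monotoneOn_univ.1 hq).measurable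

theorem MemG.measurable_indicator {g : ℝ → ℝ} (hg : MemG g) :
    Measurable ((Ioo (0 : ℝ) 1).indicator g) := by
  have hfreeze (m : ℕ) : Measurable ((Ioo (0 : ℝ) 1).indicator (freeze g (level m))) :=
    (measurable_of_boundedVariationOn (hg.boundedVariationOn_freeze m)).indicator measurableSet_Ioo
  refine measurable_of_tendsto_metrizable hfreeze (tendsto_pi_nhds.2 fun t => ?_)
  by_cases ht : t ∈ Ioo (0 : ℝ) 1
  · refine tendsto_const_nhds.congr' ?_
    filter_upwards [eventually_mem_Ioo_level ht] with m hm
    rw [indicator_of_mem ht, indicator_of_mem ht, freeze_eq hm]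
  · simp only [indicator_of_notMem ht, tendsto_const_nhds]

theorem MemG.ae_continuousAt {g : ℝ → ℝ} (hg : MemG g) :
    ∀ᵐ t, t ∈ Ioo (0 : ℝ) 1 → ContinuousAt g t := by
  have h : ∀ᵐ t, ∀ m : ℕ, DifferentiableAt ℝ (freeze g (level m)) t :=
    ae_all_iff.2 fun m =>
      (hg.boundedVariationOn_freeze m).locallyBoundedVariationOn.ae_differentiableAt
  filter_upwards [h] with t ht h01
  obtain ⟨m, hm⟩ := (eventually_mem_Ioo_level h01).exists
  refine (ht m).continuousAt.congr ?_
  filter_upwards [Ioo_mem_nhds hm.1 hm.2] with s hs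
  exact freeze_eq hs

namespace KernelAssumption

variable {k : ℝ → ℝ}

theorem integrable_id_kernelMeasure (hk : KernelAssumption k) :
    Integrable id (kernelMeasure k) := by
  rw [kernelMeasure, integrable_withDensity_iff_integrable_smul₀'
    hk.integrable.aemeasurable.ennreal_ofReal (by simp)]
  simpa only [ENNReal.toReal_ofReal (hk.nonneg _), smul_eq_mul, id, mul_comm]
    using hk.integrable_mean

theorem integral_id_kernelMeasure (hk : KernelAssumption k) :
    ∫ z, id z ∂kernelMeasure k = 0 := by
  rw [kernelMeasure, integral_withDensity_eq_integral_toReal_smul₀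
    hk.integrable.aemeasurable.ennreal_ofReal (by simp)]
  simpa only [ENNReal.toReal_ofReal (hk.nonneg _), smul_eq_mul, id, mul_comm] using hk.mean_zero

theorem setIntegral_Iic_zero_pos (hk : KernelAssumption k) : 0 < ∫ z in Iic 0, k z := by
  have := isProbabilityMeasure_kernelMeasure hk.nonneg hk.integral_eq_one
  rw [← measureReal_kernelMeasure hk.nonneg hk.integrable measurableSet_Iic]
  have hpos := measure_le_integral_pos hk.integrable_id_kernelMeasure
  rw [hk.integral_id_kernelMeasure] at hpos
  exact ENNReal.toReal_pos hpos.ne' (measure_ne_top _ _)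

theorem setIntegral_Ici_zero_pos (hk : KernelAssumption k) : 0 < ∫ z in Ici 0, k z := by
  have := isProbabilityMeasure_kernelMeasure hk.nonneg hk.integral_eq_one
  rw [← measureReal_kernelMeasure hk.nonneg hk.integrable measurableSet_Ici]
  have hpos := measure_integral_le_pos hk.integrable_id_kernelMeasure
  rw [hk.integral_id_kernelMeasure] at hpos
  exact ENNReal.toReal_pos hpos.ne' (measure_ne_top _ _)

end KernelAssumption

theorem map_eq_of_isUniform {Ω : Type*} [MeasurableSpace Ω] {P : Measure Ω} {X : Ω → ℝ}
    (hX : pdf.IsUniform X (Ioo (0 : ℝ) 1) P) : P.map X = volume.restrict (Ioo (0 : ℝ) 1) := by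
  rw [pdf.IsUniform, ProbabilityTheory.cond] at hX
  simpa using hX

theorem BoundednessAssumption.growthBound {g : ℝ → ℝ} {hg : MemG g} {c : ℕ → ℕ → ℝ} {J : ℝ → ℝ}
    {M b₁ b₂ δ : ℝ} (h : BoundednessAssumption g hg c J M b₁ b₂ δ) (hM : 0 < M) (hb₁ : 0 < b₁)
    (hb₂ : 0 < b₂) (hδ : 0 < δ) : GrowthBound g c M b₁ b₂ δ :=
  ⟨hM, hb₁, hb₂, hδ, h.g_le, h.scoreFun_le⟩

theorem GrowthBound.exists_tendsto_lStat_sub_centering {g : ℝ → ℝ} {c : ℕ → ℕ → ℝ}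
    {M b₁ b₂ δ : ℝ} (h : GrowthBound g c M b₁ b₂ δ) (hg : Measurable ((Ioo (0 : ℝ) 1).indicator g))
    (hg_cont : ∀ᵐ t, t ∈ Ioo (0 : ℝ) 1 → ContinuousAt g t) :
    ∃ r > 1, ∃ β ∈ Ioo (0 : ℝ) 1, ∀ κ : ℕ → Measure ℝ, AsympUniform κ r →
      (∃ A : ℝ≥0, ∀ᶠ n in atTop, ∫⁻ t, endWeight β t ∂κ n ≤ A) →
      Tendsto (fun n => lStat g c n (κ n) - centering g c n) atTop (𝓝 0) := by
  obtain ⟨β, hβ, hβ1⟩ := exists_between (max_lt (sub_lt_self 1 (half_pos h.δ_pos)) one_pos)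
  obtain ⟨hβδ, hβ0⟩ := max_lt_iff.1 hβ
  have hb₁ := h.b₁_pos
  have hb₂ := h.b₂_pos
  have hδ := h.δ_pos
  set ε : ℝ := δ / 2 / (b₁ + b₂)
  have hε : 0 < ε := by positivity
  have hεb : ε * (b₁ + b₂) = δ / 2 := div_mul_cancel₀ _ (by positivity)
  refine ⟨1 + ε, by linarith, β, ⟨hβ0, hβ1⟩, fun κ hκ hmoment =>
    hκ.tendsto_lStat_sub_centering hg hg_cont h ?_ ?_ hβδ ⟨hβ0, hβ1⟩ hmoment⟩
  · nlinarith
  · nlinarith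

theorem exists_one_lt_lintegral_endWeight_rpow_ne_top {β : ℝ} (hβ : β ∈ Ioo (0 : ℝ) 1) :
    ∃ p : ℝ, 1 < p ∧ ∫⁻ t, endWeight β t ^ p ≠ ∞ := by
  obtain ⟨p, hp, hpβ⟩ := exists_between ((one_lt_div hβ.1).2 hβ.2)
  have hp0 := one_pos.trans hp
  refine ⟨p, hp, ?_⟩
  simp only [endWeight_rpow β hp0]
  exact (lintegral_endWeight_lt_top (mul_pos hβ.1 hp0).le ((lt_div_iff₀' hβ.1).1 hpβ)).ne

end KernelLStat

end

open KernelLStat in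
theorem corollary2_general {Ω : Type*} [MeasurableSpace Ω] (P : Measure Ω) [IsProbabilityMeasure P]
    (ξ : ℕ → Ω → ℝ) (hξ_meas : ∀ i, Measurable (ξ i)) (hξ_indep : iIndepFun ξ P)
    (hξ_unif : ∀ i, P.map (ξ i) = volume.restrict (Ioo (0 : ℝ) 1))
    (k : ℝ → ℝ) (hk : ∀ z, 0 ≤ k z) (hk_one : ∫ z, k z = 1) (C : ℝ) (hkC : ∀ z, k z ≤ C)
    (hk_left : 0 < ∫ z in Iic 0, k z) (hk_right : 0 < ∫ z in Ici 0, k z)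
    (b : ℕ → ℝ) (hb : Tendsto b atTop (𝓝 0)) (a : ℝ) (ha : 0 < a)
    (hab : ∀ᶠ n : ℕ in atTop, a ≤ n * b n)
    (g : ℝ → ℝ) (hg : Measurable ((Ioo (0 : ℝ) 1).indicator g))
    (hg_cont : ∀ᵐ t, t ∈ Ioo (0 : ℝ) 1 → ContinuousAt g t) (c : ℕ → ℕ → ℝ)
    (M b₁ b₂ δ : ℝ) (hbound : GrowthBound g c M b₁ b₂ δ) :
    (∀ᵐ ω ∂P, Tendsto (fun n => kernelStat k b g c n (fun i => ξ i ω) - centering g c n)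
      atTop (𝓝 0)) ∧
    (∀ᵐ ω ∂P, Tendsto (fun n => orderStatSum g c n (fun i => ξ i ω) - centering g c n)
      atTop (𝓝 0)) := by
  obtain ⟨r, hr, β, hβ, hlim⟩ := hbound.exists_tendsto_lStat_sub_centering hg hg_cont
  have hunif := ae_asympUniform_empiricalMeasure hξ_meas hξ_indep hξ_unif hr
  have hweight : ∫⁻ t, endWeight β t ≠ ⊤ := (lintegral_endWeight_lt_top hβ.1.le hβ.2).ne
  constructor
  · have hki : Integrable k := .of_integral_ne_zero (by simp [hk_one])
    have := isProbabilityMeasure_kernelMeasure hk hk_one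
    rw [← measureReal_kernelMeasure hk hki measurableSet_Iic] at hk_left
    rw [← measureReal_kernelMeasure hk hki measurableSet_Ici] at hk_right
    have hb_pos : ∀ᶠ n in atTop, 0 < b n := hab.mono fun n hn =>
      pos_of_mul_pos_right (ha.trans_le hn) n.cast_nonneg
    obtain ⟨p, hp, hpβ⟩ := exists_one_lt_lintegral_endWeight_rpow_ne_top hβ
    filter_upwards [hunif, ae_exists_eventually_lintegral_smoothedMeasure_le hξ_meas hξ_indep
      hξ_unif Measure.restrict_le_self (kernelMeasure_le_smul_volume hkC) ha hab
      (measurable_endWeight β) hweight hp hpβ] with ω hω hmoment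
    refine (hlim _ (hω.smoothed hb_pos hb hk_left hk_right) hmoment).congr' ?_
    filter_upwards [hb_pos, eventually_ne_atTop 0] with n hbn hn
    rw [kernelStat_eq_lStat hk hk_one hbn hn]
  · have hmem : ∀ᵐ ω ∂P, ∀ i, ξ i ω ∈ Ioo (0 : ℝ) 1 := ae_all_iff.2 fun i =>
      ae_of_ae_map (hξ_meas i).aemeasurable (hξ_unif i ▸ ae_restrict_mem measurableSet_Ioo)
    filter_upwards [hunif, hmem, ae_exists_eventually_lintegral_empiricalMeasure_le
      hξ_meas hξ_indep hξ_unif (measurable_endWeight β) (endWeight_ne_top β)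
      (ne_top_of_le_ne_top hweight (setLIntegral_le_lintegral _ _))] with ω hω hω01 hmoment
    refine (hlim _ hω hmoment).congr' ?_
    filter_upwards [eventually_ne_atTop 0] with n hn
    rw [orderStatSum_eq_lStat g c hn hω01]

open KernelLStat in
theorem corollary2 {Ω : Type*} [MeasurableSpace Ω] (P : Measure Ω) [IsProbabilityMeasure P]
    (ξ : ℕ → Ω → ℝ) (hξ_meas : ∀ i, Measurable (ξ i)) (hξ_indep : iIndepFun ξ P)
    (hξ_unif : ∀ i, pdf.IsUniform (ξ i) (Ioo (0 : ℝ) 1) P)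
    (k : ℝ → ℝ) (hk : KernelAssumption k)
    (b : ℕ → ℝ) (hb : BandwidthAssumption b)
    (g : ℝ → ℝ) (hg : MemG g) (c : ℕ → ℕ → ℝ)
    (J : ℝ → ℝ) (hJ : Measurable ((Ioo (0 : ℝ) 1).domRestrict J))
    (M b₁ b₂ δ : ℝ) (hM : 0 < M) (hb₁ : 0 < b₁) (hb₂ : 0 < b₂) (hδ : 0 < δ)
    (hbound : BoundednessAssumption g hg c J M b₁ b₂ δ)
    (μinf : ℝ) (hμ : Tendsto (fun n => centering g c n) atTop (𝓝 μinf)) :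
    (∀ᵐ ω ∂P, Tendsto (fun n => kernelStat k b g c n (fun i => ξ i ω)) atTop (𝓝 μinf)) ∧
    (∀ᵐ ω ∂P, Tendsto (fun n => orderStatSum g c n (fun i => ξ i ω)) atTop (𝓝 μinf)) := by
  obtain ⟨C, hC⟩ := hk.bounded
  refine (corollary2_general P ξ hξ_meas hξ_indep (fun i => map_eq_of_isUniform (hξ_unif i)) k
    hk.nonneg hk.integral_eq_one C hC hk.setIntegral_Iic_zero_pos hk.setIntegral_Ici_zero_pos b
    hb.tendsto_zero 1 one_pos (hb.tendsto_mul.eventually_ge_atTop 1) g hg.measurable_indicator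
    hg.ae_continuousAt c M b₁ b₂ δ (hbound.growthBound hM hb₁ hb₂ hδ)).imp ?_ ?_ <;>
  exact fun h => h.mono fun ω hω => by simpa using hω.add hμ
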